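/- Let $\mathbb K$ be a field of characteristic $0$. For $n\ge 0$ let $$\Omega_n=\bigoplus_{p}\Omega_n^p=\frac{\mathbb K[x_0,\dots,x_n,dx_0,\dots,dx_n]}{\left(\sum_i x_i-1,\ \sum_i dx_i\right)}$$ be the differential graded algebra of polynomial differential forms on the affine standard simplex $\Delta^n_{\mathbb K}=\{x\in\mathbb K^{n+1}: \sum_i x_i=1\}$, with vertices $e_0,\dots,e_n$. For $g\colon[n]\to[m]$ nondecreasing let $g^*\colon\Omega_m\to\Omega_n$ be the pull-back along the affine map $e_i\mapsto e_{g(i)}$, and let $I(n,m)$ be the set of strictly increasing maps $[n]\to[m]$. Let $\int_{\Delta^n}\colon\Omega_n\to\mathbb K$ be the linear map vanishing on $\Omega_n^p$ for $p\ne n$ with $$\int_{\Delta^n}x_0^{k_0}\cdots x_n^{k_n}\,dx_0\wedge\dots\wedge\widehat{dx_i}\wedge\dots\wedge dx_n=(-1)^i\frac{k_0!\cdots k_n!}{(k_0+\dots+k_n+n)!}.$$ For $f\colon[n]\to[m]$ nondecreasing, the Whitney elementary form is $$\omega_f=n!\sum_{i=0}^n(-1)^i x_{f(i)}\,dx_{f(0)}\wedge\dots\wedge\widehat{dx_{f(i)}}\wedge\dots\wedge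 dx_{f(n)}\in\Omega_m^n,$$ and $\mathcal C_m\subset\Omega_m$ is the span of these forms, with inclusion $i_m$. Define $$\pi_m(\eta)=\sum_{n=0}^m\sum_{f\in I(n,m)}\Big(\int_{\Delta^n}f^*\eta\Big)\omega_f .$$ Let $\widehat\Delta^n=\{(s,t_0,\dots,t_n): s+\sum_i t_i=1\}$, regarded as the standard $(n+1)$-simplex with coordinates in this order, and let $\widehat\Omega_n$ be its algebra of polynomial forms. For $f\in I(n,m)$ let $\widehat f\colon\widehat\Delta^n\times\Delta^m_{\mathbb K}\to\Delta^m_{\mathbb K}$, $((s,t),v)\mapsto sv+\sum_i t_i e_{f(i)}$, let $k_f$ be the composite $$\Omega_m\xrightarrow{\ \widehat f^*\ }\widehat\Omega_n\otimes\Omega_m\xrightarrow{\ \int_{\widehat\Delta^n}\otimes\mathrm{Id}\ }\Omega_m,$$ where $\widehat\Omega_n\otimes\Omega_m$ is the tensor product of graded algebras (with the Koszul sign rule), and set $$k_m(\eta)=\sum_{n=0}^m\sum_{f\in I(n,m)}\omega_f\wedge k_f(\eta).$$ Then: 1. for every $m\ge0$, $\pi_m$ is a projector onto $\mathcal C_m$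 (its values lie in $\mathcal C_m$ and it is the identity on $\mathcal C_m$); 2. for every $m\ge 0$, $k_md+dk_m=i_m\pi_m-\mathrm{Id}_{\Omega_m}$; 3. for all $p,m\ge 0$ and every nondecreasing $g\colon[p]\to[m]$, $k_pg^*=g^*k_m$. Consequently $(\mathcal C_\bullet,\Omega_\bullet,i_\bullet,k_\bullet,\pi_\bullet)$ is a simplicial contraction. That is: each $\mathcal C_m$ is a graded subspace of $\Omega_m$ stable under $d$, and $g^*\mathcal C_m\subset\mathcal C_p$ for every nondecreasing $g\colon[p]\to[m]$; $i_m$ and $\pi_m\colon\Omega_m\to\mathcal C_m$ are morphisms of DG-vector spaces, $k_m$ has degree $-1$, $\pi_mi_m=\mathrm{Id}$ and $i_m\pi_m-\mathrm{Id}=dk_m+k_md$; and the pull-backs $g^*$ are functorial morphisms of DG-vector spaces $\Omega_m\to\Omega_p$ which commute with the operators $k$, the induced map $\pi_p g^* i_m\colon\mathcal C_m\to\mathcal C_p$ being the restriction of $g^*$. -/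

import Mathlib

open scoped TensorProduct DirectSum

noncomputable section

namespace PolyForm

variable (K : Type*) [Field K]

/-- The free graded-commutative algebra `K[x₀, …, xₙ, dx₀, …, dxₙ]`. -/
abbrev Free (n : ℕ) : Type _ :=
  MvPolynomial (Fin (n + 1)) K ⊗[K] ExteriorAlgebra K (Fin (n + 1) → K)

/-- The element `x₀ + ⋯ + xₙ - 1`. -/
def relX (n : ℕ) : Free K n := ((∑ i, MvPolynomial.X i) - 1) ⊗ₜ 1

/-- The element `dx₀ + ⋯ + dxₙ`. -/
def relDX (n : ℕ) : Free K n := 1 ⊗ₜ (∑ i, ExteriorAlgebra.ι K (Pi.single i 1))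

/-- The two-sided ideal `(∑ xᵢ - 1, ∑ dxᵢ)`. -/
def relIdeal (n : ℕ) : Ideal (Free K n) :=
  (TwoSidedIdeal.span {relX K n, relDX K n}).asIdeal

instance (n : ℕ) : (relIdeal K n).IsTwoSided :=
  inferInstanceAs (TwoSidedIdeal.span {relX K n, relDX K n}).asIdeal.IsTwoSided

/-- Polynomial differential forms on the affine standard `n`-simplex. -/
def Omega (n : ℕ) : Type _ := Free K n ⧸ relIdeal K n

instance (n : ℕ) : Ring (Omega K n) := inferInstanceAs (Ring (Free K n ⧸ relIdeal K n))
instance (n : ℕ) : Algebra K (Omega K n) :=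
  inferInstanceAs (Algebra K (Free K n ⧸ relIdeal K n))

/-- The quotient map from the free graded-commutative algebra. -/
def mk (n : ℕ) : Free K n →ₐ[K] Omega K n := Ideal.Quotient.mkₐ K (relIdeal K n)

/-- The coordinate function `xᵢ`. -/
def x {n : ℕ} (i : Fin (n + 1)) : Omega K n := mk K n (MvPolynomial.X i ⊗ₜ 1)

/-- The differential `dxᵢ`. -/
def dx {n : ℕ} (i : Fin (n + 1)) : Omega K n :=
  mk K n (1 ⊗ₜ ExteriorAlgebra.ι K (Pi.single i 1))

/-- The subspace of `p`-forms. -/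
def grade (n p : ℕ) : Submodule K (Omega K n) :=
  Submodule.span K
    {ω | ∃ (q : MvPolynomial (Fin (n + 1)) K)
      (w : ExteriorAlgebra K (Fin (n + 1) → K)),
        w ∈ ⋀[K]^p (Fin (n + 1) → K) ∧ ω = mk K n (q ⊗ₜ w)}

variable {K}

theorem mk_surjective (n : ℕ) : Function.Surjective (mk K n) :=
  Ideal.Quotient.mkₐ_surjective K _

theorem mk_eq_zero {n : ℕ} {z : Free K n} (hz : z ∈ relIdeal K n) : mk K n z = 0 :=
  Ideal.Quotient.eq_zero_iff_mem.2 hz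

theorem relX_mem (n : ℕ) : relX K n ∈ relIdeal K n :=
  TwoSidedIdeal.mem_asIdeal.2 (TwoSidedIdeal.subset_span (by simp))

theorem relDX_mem (n : ℕ) : relDX K n ∈ relIdeal K n :=
  TwoSidedIdeal.mem_asIdeal.2 (TwoSidedIdeal.subset_span (by simp))

/-- A linear map sends the ideal of relations into a subspace as soon as it does so on
monomial multiples of the two generators. -/
theorem map_relIdeal_le {n : ℕ} {N : Type*} [AddCommGroup N] [Module K N]
    (φ : Free K n →ₗ[K] N) (J : Submodule K N)
    (hX : ∀ p w q v, φ ((p ⊗ₜ w) * relX K n * (q ⊗ₜ v)) ∈ J)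
    (hD : ∀ p w q v, φ ((p ⊗ₜ w) * relDX K n * (q ⊗ₜ v)) ∈ J)
    {z : Free K n} (hz : z ∈ relIdeal K n) : φ z ∈ J := by
  have key : ∀ r : Free K n, (∀ p w q v, φ ((p ⊗ₜ w) * r * (q ⊗ₜ v)) ∈ J) →
      ∀ u v : Free K n, φ (u * r * v) ∈ J := by
    intro r hr u v
    induction u using TensorProduct.induction_on with
    | zero => simp
    | add a b ha hb => rw [add_mul, add_mul, map_add]; exact J.add_mem ha hb
    | tmul p w =>
      induction v using TensorProduct.induction_on with
      | zero => simp
      | add a b ha hb => rw [mul_add, map_add]; exact J.add_mem ha hb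
      | tmul q v => exact hr p w q v
  have hz' := TwoSidedIdeal.mem_span_iff_mem_addSubgroup_closure.1 (TwoSidedIdeal.mem_asIdeal.1 hz)
  induction hz' using AddSubgroup.closure_induction with
  | mem y hy =>
    obtain ⟨_, ⟨u, -, r, hr, rfl⟩, v, -, rfl⟩ := hy
    rcases hr with rfl | rfl
    · exact key _ hX u v
    · exact key _ hD u v
  | zero => simp
  | add a b ha hb h1 h2 =>
    rw [map_add]
    exact J.add_mem
      (h1 (TwoSidedIdeal.mem_asIdeal.2 (TwoSidedIdeal.mem_span_iff_mem_addSubgroup_closure.2 ha)))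
      (h2 (TwoSidedIdeal.mem_asIdeal.2 (TwoSidedIdeal.mem_span_iff_mem_addSubgroup_closure.2 hb)))
  | neg a ha h1 =>
    rw [map_neg]
    exact J.neg_mem
      (h1 (TwoSidedIdeal.mem_asIdeal.2 (TwoSidedIdeal.mem_span_iff_mem_addSubgroup_closure.2 ha)))

variable (K) in
/-- The differential of the free algebra,
`d (q dx_S) = ∑ᵢ (∂q/∂xᵢ) dxᵢ ∧ dx_S`. -/
def freeD (n : ℕ) : Free K n →ₗ[K] Free K n :=
  ∑ i : Fin (n + 1), TensorProduct.map (MvPolynomial.pderiv (R := K) i).toLinearMap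
    (LinearMap.mulLeft K (ExteriorAlgebra.ι K (Pi.single i (1 : K))))

theorem freeD_tmul {n : ℕ} (q : MvPolynomial (Fin (n + 1)) K)
    (w : ExteriorAlgebra K (Fin (n + 1) → K)) :
    freeD K n (q ⊗ₜ w) = ∑ i : Fin (n + 1),
      MvPolynomial.pderiv i q ⊗ₜ (ExteriorAlgebra.ι K (Pi.single i (1 : K)) * w) := by
  simp [freeD]

theorem freeD_mem {n : ℕ} {z : Free K n} (hz : z ∈ relIdeal K n) :
    freeD K n z ∈ relIdeal K n := by
  refine map_relIdeal_le (freeD K n) ((relIdeal K n).restrictScalars K) ?_ ?_ hz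
  · intro p w q v
    have e : freeD K n ((p ⊗ₜ w) * relX K n * (q ⊗ₜ v)) =
        (∑ i : Fin (n + 1), MvPolynomial.pderiv i (p * q) ⊗ₜ
          (ExteriorAlgebra.ι K (Pi.single i (1 : K)) * (w * v))) * relX K n +
        (p * q) ⊗ₜ 1 * relDX K n * (1 ⊗ₜ (w * v)) := by
      have e1 : (p ⊗ₜ w) * relX K n * (q ⊗ₜ v) =
          ((p * q) * ((∑ i, MvPolynomial.X i) - 1)) ⊗ₜ[K] (w * v) := by
        simp only [relX, Algebra.TensorProduct.tmul_mul_tmul, mul_one]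
        congr 1; ring
      rw [e1, freeD_tmul]
      simp only [relX, relDX, Algebra.TensorProduct.tmul_mul_tmul, mul_one, one_mul,
        Finset.sum_mul, Finset.mul_sum, TensorProduct.tmul_sum]
      rw [← Finset.sum_add_distrib]
      refine Finset.sum_congr rfl fun i _ => ?_
      rw [← TensorProduct.add_tmul]
      congr 1
      rw [Derivation.leibniz]
      simp only [map_sub, map_sum, MvPolynomial.pderiv_X, smul_eq_mul, Derivation.map_one_eq_zero,
        sub_zero]
      simp [Pi.single_apply]
      ring
    rw [e]
    exact Ideal.add_mem _ ((relIdeal K n).mul_mem_left _ (relX_mem n))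
      ((relIdeal K n).mul_mem_right _ ((relIdeal K n).mul_mem_left _ (relDX_mem n)))
  · intro p w q v
    have e : freeD K n ((p ⊗ₜ w) * relDX K n * (q ⊗ₜ v)) =
        (∑ i : Fin (n + 1), MvPolynomial.pderiv i (p * q) ⊗ₜ
          (ExteriorAlgebra.ι K (Pi.single i (1 : K)) * w)) * relDX K n * (1 ⊗ₜ v) := by
      simp only [relDX, Algebra.TensorProduct.tmul_mul_tmul, mul_one, freeD_tmul, Finset.sum_mul,
        mul_assoc]
    rw [e]
    exact (relIdeal K n).mul_mem_right _ ((relIdeal K n).mul_mem_left _ (relDX_mem n))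

variable (K) in
/-- The exterior derivative of polynomial forms, induced by `freeD`. -/
def d (n : ℕ) : Omega K n →ₗ[K] Omega K n :=
  Submodule.liftQ ((relIdeal K n).restrictScalars K) ((mk K n).toLinearMap ∘ₗ freeD K n)
    fun _ hz => mk_eq_zero (freeD_mem hz)

theorem d_mk {n : ℕ} (z : Free K n) : d K n (mk K n z) = mk K n (freeD K n z) := rfl

/-! ### Integration -/

variable (K) in
/-- The linear functional `x^k ↦ k₀! ⋯ kₙ! / (k₀ + ⋯ + kₙ + n)!` on polynomials. -/
def moment (n : ℕ) : MvPolynomial (Fin (n + 1)) K →ₗ[K] K :=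
  (MvPolynomial.basisMonomials (Fin (n + 1)) K).constr K fun k =>
    ((∏ i, (k i).factorial : ℕ) : K) / (((∑ i, k i) + n).factorial : K)

variable (K) in
/-- The coefficient of `dx₀ ∧ ⋯ ∧ dxₙ` in a constant form. -/
def topCoeff (n : ℕ) : ExteriorAlgebra K (Fin (n + 1) → K) →ₗ[K] K :=
  ExteriorAlgebra.liftAlternating
    (Pi.single (M := fun i => (Fin (n + 1) → K) [⋀^Fin i]→ₗ[K] K) (n + 1)
      Matrix.detRowAlternating)

variable (K) in
/-- The functional on constant forms that is `(-1)^i` on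
`dx₀ ∧ ⋯ ∧ (omit dxᵢ) ∧ ⋯ ∧ dxₙ`, and zero in all degrees other than `n`:
the top coefficient of `(∑ⱼ dxⱼ) ∧ w`. -/
def orient (n : ℕ) : ExteriorAlgebra K (Fin (n + 1) → K) →ₗ[K] K :=
  topCoeff K n ∘ₗ LinearMap.mulLeft K (∑ i, ExteriorAlgebra.ι K (Pi.single i (1 : K)))

variable (K) in
/-- Integration on the free algebra. -/
def freeIntegral (n : ℕ) : Free K n →ₗ[K] K :=
  LinearMap.mul' K K ∘ₗ TensorProduct.map (moment K n) (orient K n)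

theorem moment_monomial {n : ℕ} (k : Fin (n + 1) →₀ ℕ) :
    moment K n (MvPolynomial.monomial k 1) =
      ((∏ i, (k i).factorial : ℕ) : K) / (((∑ i, k i) + n).factorial : K) := by
  have := (MvPolynomial.basisMonomials (Fin (n + 1)) K).constr_basis K (fun k =>
    ((∏ i, (k i).factorial : ℕ) : K) / (((∑ i, k i) + n).factorial : K)) k
  rwa [MvPolynomial.coe_basisMonomials] at this

theorem freeIntegral_tmul {n : ℕ} (q : MvPolynomial (Fin (n + 1)) K)
    (w : ExteriorAlgebra K (Fin (n + 1) → K)) :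
    freeIntegral K n (q ⊗ₜ w) = moment K n q * orient K n w := by
  simp [freeIntegral]

theorem moment_mul_rel [CharZero K] {n : ℕ} (q : MvPolynomial (Fin (n + 1)) K) :
    moment K n (q * ((∑ i, MvPolynomial.X i) - 1)) = 0 := by
  suffices h : moment K n ∘ₗ LinearMap.mulRight K
      ((∑ i, MvPolynomial.X i) - 1 : MvPolynomial (Fin (n + 1)) K) = 0 from
    LinearMap.congr_fun h q
  refine (MvPolynomial.basisMonomials (Fin (n + 1)) K).ext fun k => ?_
  simp only [MvPolynomial.coe_basisMonomials, LinearMap.comp_apply, LinearMap.mulRight_apply,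
    mul_sub, mul_one, Finset.mul_sum, map_sub, map_sum, LinearMap.zero_apply]
  have h1 : ∀ j : Fin (n + 1), moment K n (MvPolynomial.monomial k 1 * MvPolynomial.X j) =
      ((k j : K) + 1) * ((∏ i, (k i).factorial : ℕ) : K) /
        (((∑ i, k i) + n + 1).factorial : K) := by
    intro j
    rw [MvPolynomial.X, MvPolynomial.monomial_mul, one_mul, moment_monomial]
    have e1 : ∏ i, ((k + Finsupp.single j 1 : Fin (n + 1) →₀ ℕ) i).factorial =
        (k j + 1) * ∏ i, (k i).factorial := by
      rw [← Finset.mul_prod_erase _ _ (Finset.mem_univ j),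
        ← Finset.mul_prod_erase Finset.univ (fun i => (k i).factorial) (Finset.mem_univ j),
        ← mul_assoc]
      congr 1
      · simp [Nat.factorial_succ]
      · refine Finset.prod_congr rfl fun i hi => ?_
        simp [(Finset.ne_of_mem_erase hi).symm]
    have e2 : ∑ i, (k + Finsupp.single j 1 : Fin (n + 1) →₀ ℕ) i + n = ∑ i, k i + n + 1 := by
      simp [Finset.sum_add_distrib, Finsupp.single_apply]
      ring
    rw [e1, e2]
    push_cast
    rfl
  simp only [h1, moment_monomial]
  rw [← Finset.sum_div, ← Finset.sum_mul, Nat.factorial_succ]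
  have h2 : (((∑ i, k i) + n).factorial : K) ≠ 0 := by exact_mod_cast Nat.factorial_ne_zero _
  have h3 : (((∑ i, k i) + n + 1 : ℕ) : K) ≠ 0 :=
    Nat.cast_ne_zero.2 (Nat.succ_ne_zero _)
  have h4 : ∑ i, ((k i : K) + 1) = (((∑ i, k i) + n + 1 : ℕ) : K) := by
    simp [Finset.sum_add_distrib]; ring
  rw [h4]
  push_cast at *
  field_simp
  simp

theorem ι_mul_eq {M : Type*} [AddCommGroup M] [Module K M] (m : M) (w : ExteriorAlgebra K M) :
    ExteriorAlgebra.ι K m * w = CliffordAlgebra.involute w * ExteriorAlgebra.ι K m := by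
  induction w using ExteriorAlgebra.induction with
  | algebraMap r => rw [AlgHom.commutes, Algebra.commutes]
  | ι v =>
    rw [show CliffordAlgebra.involute (ExteriorAlgebra.ι K v) = -ExteriorAlgebra.ι K v from
      CliffordAlgebra.involute_ι v, neg_mul]
    exact eq_neg_of_add_eq_zero_left (ExteriorAlgebra.ι_add_mul_swap m v)
  | mul a b ha hb => rw [← mul_assoc, ha, mul_assoc, hb, ← mul_assoc, ← map_mul]
  | add a b ha hb => rw [mul_add, ha, hb, map_add, add_mul]

theorem freeIntegral_eq_zero [CharZero K] {n : ℕ} {z : Free K n} (hz : z ∈ relIdeal K n) :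
    freeIntegral K n z = 0 := by
  refine map_relIdeal_le (freeIntegral K n) ⊥ ?_ ?_ hz
  · intro p w q v
    rw [Submodule.mem_bot, relX, Algebra.TensorProduct.tmul_mul_tmul,
      Algebra.TensorProduct.tmul_mul_tmul, freeIntegral_tmul, mul_right_comm, moment_mul_rel,
      zero_mul]
  · intro p w q v
    rw [Submodule.mem_bot, relDX, Algebra.TensorProduct.tmul_mul_tmul,
      Algebra.TensorProduct.tmul_mul_tmul, freeIntegral_tmul, orient, LinearMap.comp_apply,
      LinearMap.mulLeft_apply, ← map_sum, ← mul_assoc, ← mul_assoc, ι_mul_eq, mul_assoc _ _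
      (ExteriorAlgebra.ι K _), ExteriorAlgebra.ι_sq_zero]
    simp

variable (K) in
/-- Integration over the affine standard `n`-simplex. -/
def integral [CharZero K] (n : ℕ) : Omega K n →ₗ[K] K :=
  Submodule.liftQ ((relIdeal K n).restrictScalars K) (freeIntegral K n)
    fun _ hz => freeIntegral_eq_zero hz

theorem integral_mk [CharZero K] {n : ℕ} (z : Free K n) :
    integral K n (mk K n z) = freeIntegral K n z := rfl

/-- The integral vanishes on `p`-forms with `p ≠ n`. -/
theorem integral_of_ne [CharZero K] {n p : ℕ} (hp : p ≠ n) {η : Omega K n}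
    (hη : η ∈ grade K n p) : integral K n η = 0 := by
  induction hη using Submodule.span_induction with
  | mem η h =>
    obtain ⟨q, w, hw, rfl⟩ := h
    suffices orient K n w = 0 by
      rw [integral_mk, freeIntegral_tmul, this, mul_zero]
    rw [← ExteriorAlgebra.ιMulti_span_fixedDegree] at hw
    induction hw using Submodule.span_induction with
    | mem w h =>
      obtain ⟨v, rfl⟩ := h
      rw [orient, LinearMap.comp_apply, LinearMap.mulLeft_apply, ← map_sum, topCoeff,
        ExteriorAlgebra.ιMulti_apply]
      have e : ExteriorAlgebra.ι K (∑ i : Fin (n + 1), Pi.single i (1 : K)) *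
          (List.ofFn fun i => ExteriorAlgebra.ι K (v i)).prod =
          ExteriorAlgebra.ιMulti K (p + 1)
            (Fin.cons (∑ i : Fin (n + 1), Pi.single i (1 : K)) v) := by
        rw [ExteriorAlgebra.ιMulti_apply, List.ofFn_succ]; simp
      rw [e, ExteriorAlgebra.liftAlternating_apply_ιMulti, Pi.single_eq_of_ne (by omega)]
      rfl
    | zero => simp
    | add a b _ _ ha hb => rw [map_add, ha, hb, add_zero]
    | smul c a _ ha => rw [map_smul, ha, smul_zero]
  | zero => simp
  | add a b _ _ ha hb => rw [map_add, ha, hb, add_zero]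
  | smul c a _ ha => rw [map_smul, ha, smul_zero]

theorem det_cons_single {n : ℕ} (i : Fin (n + 1)) :
    Matrix.det (Matrix.of (Fin.cons (∑ i : Fin (n + 1), Pi.single i (1 : K))
      fun j => Pi.single (i.succAbove j) (1 : K))) = (-1) ^ (i : ℕ) := by
  rw [Matrix.det_succ_row_zero, Finset.sum_eq_single i]
  · have h2 : Matrix.submatrix (Matrix.of (Fin.cons (∑ i : Fin (n + 1), Pi.single i (1 : K))
        fun j => Pi.single (i.succAbove j) (1 : K))) Fin.succ i.succAbove = 1 := by
      ext a b
      simp [Matrix.one_apply, Pi.single_apply, eq_comm]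
    rw [h2, Matrix.det_one]
    simp [Finset.sum_apply, Pi.single_apply]
  · intro j _ hj
    obtain ⟨a, ha⟩ := Fin.exists_succAbove_eq hj
    rw [Matrix.det_eq_zero_of_row_eq_zero a, mul_zero]
    intro b
    simp [ha, Fin.succAbove_ne]
  · simp

/-- The values of the integral on top-degree monomial forms. -/
theorem integral_monomial [CharZero K] {n : ℕ} (k : Fin (n + 1) → ℕ) (i : Fin (n + 1)) :
    integral K n ((List.ofFn fun j => x K j ^ k j).prod *
        (List.ofFn fun j : Fin n => dx K (i.succAbove j)).prod) =
      (-1) ^ (i : ℕ) * ((∏ j, ((k j).factorial : K)) / (((∑ j, k j) + n).factorial : K)) := by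
  have e1 : (List.ofFn fun j => x K j ^ k j).prod =
      mk K n (MvPolynomial.monomial (Finsupp.equivFunOnFinite.symm k) 1 ⊗ₜ 1) := by
    have : (MvPolynomial.monomial (Finsupp.equivFunOnFinite.symm k) (1 : K) :
        MvPolynomial (Fin (n + 1)) K) ⊗ₜ[K] (1 : ExteriorAlgebra K (Fin (n + 1) → K)) =
        (List.ofFn fun j : Fin (n + 1) => ((MvPolynomial.X j : MvPolynomial (Fin (n + 1)) K) ⊗ₜ[K]
          (1 : ExteriorAlgebra K (Fin (n + 1) → K))) ^ k j).prod := by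
      rw [MvPolynomial.monomial_eq, Finsupp.prod_fintype _ _ (by simp), ← List.prod_ofFn]
      simp only [map_one, one_mul]
      have := map_list_prod (Algebra.TensorProduct.includeLeft (R := K) (S := K)
        (A := MvPolynomial (Fin (n + 1)) K) (B := ExteriorAlgebra K (Fin (n + 1) → K)))
        (List.ofFn fun j : Fin (n + 1) => (MvPolynomial.X j : MvPolynomial (Fin (n + 1)) K) ^ k j)
      simp only [List.map_ofFn, Function.comp_def, map_pow,
        Algebra.TensorProduct.includeLeft_apply] at this
      exact this
    rw [this, map_list_prod]
    simp only [List.map_ofFn, Function.comp_def, map_pow, x]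
  have e2 : (List.ofFn fun j : Fin n => dx K (i.succAbove j)).prod =
      mk K n (1 ⊗ₜ ExteriorAlgebra.ιMulti K n fun j => Pi.single (i.succAbove j) (1 : K)) := by
    have := map_list_prod (Algebra.TensorProduct.includeRight (R := K)
        (A := MvPolynomial (Fin (n + 1)) K) (B := ExteriorAlgebra K (Fin (n + 1) → K)))
        (List.ofFn fun j : Fin n => ExteriorAlgebra.ι K (Pi.single (i.succAbove j) (1 : K)))
    rw [ExteriorAlgebra.ιMulti_apply]
    simp only [Algebra.TensorProduct.includeRight_apply] at this
    rw [this, map_list_prod]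
    simp only [List.map_ofFn, Function.comp_def, dx]
    rfl
  rw [e1, e2, ← map_mul, Algebra.TensorProduct.tmul_mul_tmul, mul_one, one_mul]
  rw [integral_mk, freeIntegral_tmul, moment_monomial, mul_comm]
  congr 1
  · rw [orient, LinearMap.comp_apply, LinearMap.mulLeft_apply, ← map_sum, topCoeff]
    have e : ExteriorAlgebra.ι K (∑ i : Fin (n + 1), Pi.single i (1 : K)) *
          ExteriorAlgebra.ιMulti K n (fun j => Pi.single (i.succAbove j) (1 : K)) =
          ExteriorAlgebra.ιMulti K (n + 1)
            (Fin.cons (∑ i : Fin (n + 1), Pi.single i (1 : K))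
              fun j => Pi.single (i.succAbove j) (1 : K)) := by
      rw [ExteriorAlgebra.ιMulti_apply, ExteriorAlgebra.ιMulti_apply, List.ofFn_succ]; simp
    rw [e, ExteriorAlgebra.liftAlternating_apply_ιMulti, Pi.single_eq_same]
    exact det_cons_single i
  · simp

/-! ### Algebra maps out of `Omega`, and the grading -/

section Lift

variable {B : Type*} [Ring B] [Algebra K B] {n : ℕ}

/-- The algebra map out of the free graded-commutative algebra with prescribed values. -/
def freeLift (f : MvPolynomial (Fin (n + 1)) K →ₐ[K] B) (θ : (Fin (n + 1) → K) →ₗ[K] B)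
    (hsq : ∀ v, θ v * θ v = 0) (hcomm : ∀ q v, Commute (f q) (θ v)) : Free K n →ₐ[K] B :=
  Algebra.TensorProduct.lift f (ExteriorAlgebra.lift K ⟨θ, hsq⟩) (by
    intro q w
    induction w using ExteriorAlgebra.induction with
    | algebraMap r => rw [AlgHom.commutes]; exact (Algebra.commutes r _).symm
    | ι v => rw [ExteriorAlgebra.lift_ι_apply]; exact hcomm q v
    | mul a b ha hb => rw [map_mul]; exact ha.mul_right hb
    | add a b ha hb => rw [map_add]; exact ha.add_right hb)

/-- The universal property of `Omega K n`: an algebra map is given by the images of the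
polynomials and of the `dxᵢ`. -/
def lift (f : MvPolynomial (Fin (n + 1)) K →ₐ[K] B) (θ : (Fin (n + 1) → K) →ₗ[K] B)
    (hsq : ∀ v, θ v * θ v = 0) (hcomm : ∀ q v, Commute (f q) (θ v))
    (hX : f (∑ i, MvPolynomial.X i) = 1) (hD : ∑ i, θ (Pi.single i 1) = 0) :
    Omega K n →ₐ[K] B :=
  Ideal.Quotient.liftₐ (relIdeal K n) (freeLift f θ hsq hcomm) (by
    intro z hz
    refine map_relIdeal_le (freeLift f θ hsq hcomm).toLinearMap ⊥ ?_ ?_ hz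
    · intro p w q v
      have : freeLift f θ hsq hcomm (relX K n) = 0 := by
        rw [relX, freeLift, Algebra.TensorProduct.lift_tmul, map_sub, hX, map_one, map_one,
          sub_self, zero_mul]
      rw [AlgHom.toLinearMap_apply, map_mul, map_mul, this, mul_zero, zero_mul, Submodule.mem_bot]
    · intro p w q v
      have : freeLift f θ hsq hcomm (relDX K n) = 0 := by
        simp only [relDX, freeLift, Algebra.TensorProduct.lift_tmul, map_sum,
          ExteriorAlgebra.lift_ι_apply, hD, mul_zero]
      rw [AlgHom.toLinearMap_apply, map_mul, map_mul, this, mul_zero, zero_mul, Submodule.mem_bot])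

theorem lift_mk (f : MvPolynomial (Fin (n + 1)) K →ₐ[K] B) (θ : (Fin (n + 1) → K) →ₗ[K] B)
    (hsq hcomm hX hD) (q : MvPolynomial (Fin (n + 1)) K)
    (w : ExteriorAlgebra K (Fin (n + 1) → K)) :
    lift f θ hsq hcomm hX hD (mk K n (q ⊗ₜ w)) = f q * ExteriorAlgebra.lift K ⟨θ, hsq⟩ w := rfl

theorem algHom_ext {f g : Omega K n →ₐ[K] B} (hx : ∀ i, f (x K i) = g (x K i))
    (hdx : ∀ i, f (dx K i) = g (dx K i)) : f = g := by
  refine Ideal.Quotient.algHom_ext K (?_ : f.comp (mk K n) = g.comp (mk K n))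
  ext i
  · exact hx i
  · exact hdx i

end Lift

/-- A polynomial as a `0`-form. -/
def poly (n : ℕ) : MvPolynomial (Fin (n + 1)) K →ₐ[K] Omega K n :=
  (mk K n).comp Algebra.TensorProduct.includeLeft

/-- A covector as a constant `1`-form. -/
def covec (n : ℕ) : (Fin (n + 1) → K) →ₗ[K] Omega K n :=
  (mk K n).toLinearMap ∘ₗ (Algebra.TensorProduct.includeRight (R := K)
    (A := MvPolynomial (Fin (n + 1)) K)).toLinearMap ∘ₗ ExteriorAlgebra.ι K

theorem poly_X {n : ℕ} (i : Fin (n + 1)) : poly n (MvPolynomial.X i) = x K i := rfl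

theorem covec_single {n : ℕ} (i : Fin (n + 1)) : covec n (Pi.single i 1) = dx K i := rfl

theorem lift_poly {B : Type*} [Ring B] [Algebra K B] {n : ℕ}
    (f : MvPolynomial (Fin (n + 1)) K →ₐ[K] B) (θ : (Fin (n + 1) → K) →ₗ[K] B)
    (hsq hcomm hX hD) (q : MvPolynomial (Fin (n + 1)) K) :
    lift f θ hsq hcomm hX hD (poly n q) = f q := by
  rw [poly, AlgHom.comp_apply, Algebra.TensorProduct.includeLeft_apply, lift_mk, map_one, mul_one]

theorem lift_covec {B : Type*} [Ring B] [Algebra K B] {n : ℕ}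
    (f : MvPolynomial (Fin (n + 1)) K →ₐ[K] B) (θ : (Fin (n + 1) → K) →ₗ[K] B)
    (hsq hcomm hX hD) (v : Fin (n + 1) → K) :
    lift f θ hsq hcomm hX hD (covec n v) = θ v := by
  rw [covec, LinearMap.comp_apply, LinearMap.comp_apply, AlgHom.toLinearMap_apply,
    AlgHom.toLinearMap_apply, Algebra.TensorProduct.includeRight_apply, lift_mk, map_one, one_mul,
    ExteriorAlgebra.lift_ι_apply]

theorem covec_sq {n : ℕ} (v : Fin (n + 1) → K) : covec n v * covec n v = 0 := by
  simp only [covec, LinearMap.comp_apply, AlgHom.toLinearMap_apply]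
  rw [← map_mul, ← map_mul, ExteriorAlgebra.ι_sq_zero, map_zero, map_zero]

theorem poly_commute {n : ℕ} (q : MvPolynomial (Fin (n + 1)) K) (z : Omega K n) :
    Commute (poly n q) z := by
  obtain ⟨z, rfl⟩ := mk_surjective n z
  refine Commute.map (f := mk K n) (x := q ⊗ₜ 1) ?_
  induction z using TensorProduct.induction_on with
  | zero => exact Commute.zero_right _
  | add a b ha hb => exact ha.add_right hb
  | tmul p w =>
    simp [Commute, SemiconjBy, mul_comm]

theorem poly_sum {n : ℕ} : poly n (∑ i, MvPolynomial.X i : MvPolynomial (Fin (n + 1)) K) = 1 := by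
  have h := mk_eq_zero (relX_mem (K := K) n)
  rw [relX, TensorProduct.sub_tmul, map_sub, sub_eq_zero] at h
  exact h.trans (map_one (mk K n))

theorem covec_sum {n : ℕ} : ∑ i, covec n (Pi.single i (1 : K) : Fin (n + 1) → K) = 0 := by
  have h := mk_eq_zero (relDX_mem (K := K) n)
  rw [relDX, TensorProduct.tmul_sum, map_sum] at h
  exact h

theorem poly_mem {n : ℕ} (q : MvPolynomial (Fin (n + 1)) K) : poly n q ∈ grade K n 0 :=
  Submodule.subset_span ⟨q, 1, by simp, rfl⟩

theorem covec_mem {n : ℕ} (v : Fin (n + 1) → K) : covec n v ∈ grade K n 1 :=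
  Submodule.subset_span ⟨1, ExteriorAlgebra.ι K v, by simp, rfl⟩

instance gradedMonoid (n : ℕ) : SetLike.GradedMonoid (grade K n) where
  one_mem := by simpa using poly_mem (K := K) (n := n) 1
  mul_mem i j a b ha hb := by
    induction ha, hb using Submodule.span_induction₂ with
    | mem_mem a b ha hb =>
      obtain ⟨q, w, hw, rfl⟩ := ha
      obtain ⟨p, v, hv, rfl⟩ := hb
      rw [← map_mul, Algebra.TensorProduct.tmul_mul_tmul]
      exact Submodule.subset_span ⟨_, _, SetLike.mul_mem_graded hw hv, rfl⟩
    | zero_left => simp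
    | zero_right => simp
    | add_left _ _ _ _ _ _ h1 h2 => rw [add_mul]; exact Submodule.add_mem _ h1 h2
    | add_right _ _ _ _ _ _ h1 h2 => rw [mul_add]; exact Submodule.add_mem _ h1 h2
    | smul_left r _ _ _ _ h => rw [smul_mul_assoc]; exact Submodule.smul_mem _ _ h
    | smul_right r _ _ _ _ h => rw [mul_smul_comm]; exact Submodule.smul_mem _ _ h

/-- Auxiliary map for the grading. -/
def polyGr (n : ℕ) : MvPolynomial (Fin (n + 1)) K →ₐ[K] ⨁ i, grade K n i :=
  AlgHom.ofLinearMap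
    (DirectSum.lof K ℕ (fun i => grade K n i) 0 ∘ₗ
      (poly n).toLinearMap.codRestrict (grade K n 0) poly_mem)
    (by
      rw [LinearMap.comp_apply, DirectSum.lof_eq_of, DirectSum.one_def]
      exact congrArg _ (Subtype.ext (map_one (poly n))))
    (by
      intro p q
      simp only [LinearMap.comp_apply, DirectSum.lof_eq_of]
      rw [DirectSum.of_mul_of]
      refine DirectSum.of_eq_of_gradedMonoid_eq (Sigma.subtype_ext (zero_add 0).symm ?_)
      exact map_mul (poly n) p q)

/-- Auxiliary map for the grading. -/
def covecGr (n : ℕ) : (Fin (n + 1) → K) →ₗ[K] ⨁ i, grade K n i :=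
  DirectSum.lof K ℕ (fun i => grade K n i) 1 ∘ₗ
      (covec n).codRestrict (grade K n 1) covec_mem

theorem polyGr_apply {n : ℕ} (q : MvPolynomial (Fin (n + 1)) K) :
    polyGr n q = DirectSum.of (fun i => grade K n i) 0 ⟨poly n q, poly_mem q⟩ := rfl

theorem covecGr_apply {n : ℕ} (v : Fin (n + 1) → K) :
    covecGr n v = DirectSum.of (fun i => grade K n i) 1 ⟨covec n v, covec_mem v⟩ := rfl

theorem covecGr_sq {n : ℕ} (v : Fin (n + 1) → K) : covecGr n v * covecGr n v = 0 := by
  rw [covecGr_apply, DirectSum.of_mul_of]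
  exact DFinsupp.single_eq_zero.mpr (Subtype.ext (covec_sq v))

theorem polyGr_commute {n : ℕ} (q : MvPolynomial (Fin (n + 1)) K) (v : Fin (n + 1) → K) :
    Commute (polyGr n q) (covecGr n v) := by
  rw [polyGr_apply, covecGr_apply, Commute, SemiconjBy, DirectSum.of_mul_of,
    DirectSum.of_mul_of]
  exact DirectSum.of_eq_of_gradedMonoid_eq
    (Sigma.subtype_ext (add_comm _ _) (poly_commute q (covec n v)).eq)

theorem polyGr_sum (n : ℕ) :
    polyGr n (∑ i, MvPolynomial.X i : MvPolynomial (Fin (n + 1)) K) = 1 := by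
  rw [polyGr_apply, DirectSum.one_def]
  exact congrArg _ (Subtype.ext poly_sum)

theorem covecGr_sum (n : ℕ) : ∑ i, covecGr n (Pi.single i (1 : K) : Fin (n + 1) → K) = 0 := by
  rw [← map_sum, covecGr_apply]
  refine DFinsupp.single_eq_zero.mpr (Subtype.ext ?_)
  exact (map_sum _ _ _).trans covec_sum

/-- Auxiliary map for the grading. -/
def toGr (n : ℕ) : Omega K n →ₐ[K] ⨁ i, grade K n i :=
  lift (K := K) (n := n) (B := ⨁ i, grade K n i) (polyGr n) (covecGr n) covecGr_sq polyGr_commute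
    (polyGr_sum (K := K) n) (covecGr_sum (K := K) n)

/-- `toGr` sends `η` to itself, placed in degree `i`. -/
def IsHom (n i : ℕ) (η : Omega K n) : Prop :=
  ∃ h : η ∈ grade K n i, toGr n η = DirectSum.of (fun i => grade K n i) i ⟨η, h⟩

theorem IsHom.zero (n i : ℕ) : IsHom n i (0 : Omega K n) :=
  ⟨Submodule.zero_mem _, by
    rw [map_zero]
    exact (map_zero (DirectSum.of (fun i => grade K n i) i)).symm⟩

theorem IsHom.add {n i : ℕ} {a b : Omega K n} (ha : IsHom n i a) (hb : IsHom n i b) :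
    IsHom n i (a + b) := by
  obtain ⟨ha, ea⟩ := ha
  obtain ⟨hb, eb⟩ := hb
  exact ⟨Submodule.add_mem _ ha hb, by rw [map_add, ea, eb, ← map_add, AddMemClass.mk_add_mk]⟩

theorem IsHom.smul {n i : ℕ} (c : K) {a : Omega K n} (ha : IsHom n i a) :
    IsHom n i (c • a) := by
  obtain ⟨ha, ea⟩ := ha
  exact ⟨Submodule.smul_mem _ c ha, by
    rw [map_smul, ea, ← DirectSum.lof_eq_of K, ← map_smul, SetLike.mk_smul_mk,
      DirectSum.lof_eq_of]⟩

theorem IsHom.mul {n i j k : ℕ} {a b : Omega K n} (ha : IsHom n i a) (hb : IsHom n j b)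
    (hk : i + j = k) : IsHom n k (a * b) := by
  subst hk
  obtain ⟨ha, ea⟩ := ha
  obtain ⟨hb, eb⟩ := hb
  exact ⟨SetLike.mul_mem_graded ha hb, by rw [map_mul, ea, eb, DirectSum.of_mul_of]; rfl⟩

theorem isHom_poly {n : ℕ} (q : MvPolynomial (Fin (n + 1)) K) : IsHom n 0 (poly n q) :=
  ⟨poly_mem q, by rw [← polyGr_apply, toGr, lift_poly]⟩

theorem isHom_covec {n : ℕ} (v : Fin (n + 1) → K) : IsHom n 1 (covec n v) :=
  ⟨covec_mem v, by rw [← covecGr_apply, toGr, lift_covec]⟩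

theorem mk_tmul {n : ℕ} (q : MvPolynomial (Fin (n + 1)) K)
    (w : ExteriorAlgebra K (Fin (n + 1) → K)) :
    mk K n (q ⊗ₜ w) = poly n q * mk K n (1 ⊗ₜ w) := by
  rw [poly, AlgHom.comp_apply, Algebra.TensorProduct.includeLeft_apply, ← map_mul,
    Algebra.TensorProduct.tmul_mul_tmul, mul_one, one_mul]

theorem mk_one_tmul_ι_mul {n : ℕ} (v : Fin (n + 1) → K)
    (w : ExteriorAlgebra K (Fin (n + 1) → K)) :
    mk K n (1 ⊗ₜ (ExteriorAlgebra.ι K v * w)) = covec n v * mk K n (1 ⊗ₜ w) := by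
  rw [covec, LinearMap.comp_apply, LinearMap.comp_apply, AlgHom.toLinearMap_apply,
    AlgHom.toLinearMap_apply, Algebra.TensorProduct.includeRight_apply, ← map_mul,
    Algebra.TensorProduct.tmul_mul_tmul, mul_one]

theorem isHom_mk {n i : ℕ} {w : ExteriorAlgebra K (Fin (n + 1) → K)}
    (hw : w ∈ ⋀[K]^i (Fin (n + 1) → K)) : IsHom n i (mk K n (1 ⊗ₜ w)) := by
  induction hw using Submodule.pow_induction_on_left' with
  | algebraMap r =>
    have h := (isHom_poly (n := n) (1 : MvPolynomial (Fin (n + 1)) K)).smul r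
    rwa [Algebra.algebraMap_eq_smul_one, TensorProduct.tmul_smul, map_smul,
      ← Algebra.TensorProduct.one_def, map_one (mk K n), ← map_one (poly n)]
  | add a b i ha hb iha ihb =>
    rw [TensorProduct.tmul_add, map_add]
    exact iha.add ihb
  | mem_mul m hm i a ha iha =>
    obtain ⟨v, rfl⟩ := hm
    rw [mk_one_tmul_ι_mul]
    exact (isHom_covec v).mul iha (add_comm _ _)

theorem isHom_of_mem {n i : ℕ} {η : Omega K n} (hη : η ∈ grade K n i) : IsHom n i η := by
  induction hη using Submodule.span_induction with
  | mem η h =>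
    obtain ⟨q, w, hw, rfl⟩ := h
    rw [mk_tmul]
    exact (isHom_poly q).mul (isHom_mk hw) (zero_add _)
  | zero => exact IsHom.zero n i
  | add a b _ _ h1 h2 => exact h1.add h2
  | smul c a _ h => exact h.smul c

theorem toGr_of_mem {n i : ℕ} (η : grade K n i) :
    toGr n (η : Omega K n) = DirectSum.of (fun i => grade K n i) i η :=
  (isHom_of_mem η.2).2

instance gradedAlgebra (n : ℕ) : GradedAlgebra (grade K n) :=
  GradedAlgebra.ofAlgHom (grade K n) (toGr n)
    (by
      refine algHom_ext (K := K) (n := n) (fun i => ?_) (fun i => ?_)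
      · rw [AlgHom.comp_apply, ← poly_X, toGr_of_mem ⟨_, poly_mem (MvPolynomial.X i)⟩,
          DirectSum.coeAlgHom_of]
        rfl
      · rw [AlgHom.comp_apply, ← covec_single, toGr_of_mem ⟨_, covec_mem (Pi.single i 1)⟩,
          DirectSum.coeAlgHom_of]
        rfl)
    (fun _ η => toGr_of_mem η)

/-! ### Pull-backs -/

/-- The substitution `xⱼ ↦ ∑_{g(i) = j} xᵢ` on polynomials. -/
def pullbackPoly {n m : ℕ} (g : Fin (n + 1) → Fin (m + 1)) :
    MvPolynomial (Fin (m + 1)) K →ₐ[K] Omega K n :=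
  (poly n).comp (MvPolynomial.aeval fun j => ∑ i with g i = j, MvPolynomial.X i)

/-- The substitution `dxⱼ ↦ ∑_{g(i) = j} dxᵢ` on covectors. -/
def pullbackCovec {n m : ℕ} (g : Fin (n + 1) → Fin (m + 1)) :
    (Fin (m + 1) → K) →ₗ[K] Omega K n :=
  covec n ∘ₗ LinearMap.funLeft K K g

theorem pullbackPoly_X {n m : ℕ} (g : Fin (n + 1) → Fin (m + 1)) (j : Fin (m + 1)) :
    pullbackPoly g (MvPolynomial.X j) = ∑ i with g i = j, x K i := by
  rw [pullbackPoly, AlgHom.comp_apply, MvPolynomial.aeval_X, map_sum]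
  rfl

theorem pullbackCovec_single {n m : ℕ} (g : Fin (n + 1) → Fin (m + 1)) (j : Fin (m + 1)) :
    pullbackCovec g (Pi.single j (1 : K)) = ∑ i with g i = j, dx K i := by
  simp only [← covec_single, ← map_sum, pullbackCovec, LinearMap.comp_apply]
  congr 1
  ext i
  simp [LinearMap.funLeft, Finset.sum_apply, Pi.single_apply]

theorem pullbackPoly_sum {n m : ℕ} (g : Fin (n + 1) → Fin (m + 1)) :
    pullbackPoly g (∑ j, MvPolynomial.X j : MvPolynomial (Fin (m + 1)) K) = 1 := by
  rw [map_sum]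
  simp only [pullbackPoly_X]
  rw [Finset.sum_fiberwise, ← poly_sum (K := K) (n := n), map_sum]
  rfl

theorem pullbackCovec_sum {n m : ℕ} (g : Fin (n + 1) → Fin (m + 1)) :
    ∑ j, pullbackCovec g (Pi.single j (1 : K)) = 0 := by
  simp only [pullbackCovec_single]
  rw [Finset.sum_fiberwise]
  exact covec_sum (K := K)

theorem pullbackCovec_sq {n m : ℕ} (g : Fin (n + 1) → Fin (m + 1)) (v : Fin (m + 1) → K) :
    pullbackCovec g v * pullbackCovec g v = 0 := by
  rw [pullbackCovec, LinearMap.comp_apply, covec_sq]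

theorem pullbackPoly_commute {n m : ℕ} (g : Fin (n + 1) → Fin (m + 1))
    (q : MvPolynomial (Fin (m + 1)) K) (v : Fin (m + 1) → K) :
    Commute (pullbackPoly g q) (pullbackCovec g v) := by
  rw [pullbackPoly, AlgHom.comp_apply]
  exact poly_commute _ _

/-- The pull-back along the affine map `Δⁿ → Δᵐ`, `eᵢ ↦ e_{g(i)}`:
`xⱼ ↦ ∑_{g(i) = j} xᵢ` and `dxⱼ ↦ ∑_{g(i) = j} dxᵢ`. -/
def pullback {n m : ℕ} (g : Fin (n + 1) → Fin (m + 1)) : Omega K m →ₐ[K] Omega K n :=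
  lift (K := K) (n := m) (B := Omega K n) (pullbackPoly g) (pullbackCovec g)
    (pullbackCovec_sq (K := K) g) (pullbackPoly_commute (K := K) g)
    (pullbackPoly_sum (K := K) g) (pullbackCovec_sum (K := K) g)

theorem pullback_x {n m : ℕ} (g : Fin (n + 1) → Fin (m + 1)) (j : Fin (m + 1)) :
    pullback g (x K j) = ∑ i with g i = j, x K i := by
  rw [← poly_X, pullback, lift_poly, pullbackPoly_X]

theorem pullback_dx {n m : ℕ} (g : Fin (n + 1) → Fin (m + 1)) (j : Fin (m + 1)) :
    pullback g (dx K j) = ∑ i with g i = j, dx K i := by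
  rw [← covec_single, pullback, lift_covec, pullbackCovec_single]

variable (K) in
/-- Forms on `Δ̂ⁿ × Δᵐ`, that is `Ω̂ₙ ⊗ Ωₘ` with the Koszul sign rule. The simplex `Δ̂ⁿ`, with
coordinates `(s, t₀, …, tₙ)` in this order, is the affine standard `(n+1)`-simplex. -/
abbrev HatOmega (n m : ℕ) : Type _ := grade K (n + 1) ᵍ⊗[K] grade K m

theorem x_mem {n : ℕ} (i : Fin (n + 1)) : x K i ∈ grade K n 0 := poly_mem _

theorem dx_mem {n : ℕ} (i : Fin (n + 1)) : dx K i ∈ grade K n 1 := covec_mem _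

theorem tmul_mul_tmul_of_mem {n m i j : ℕ} (a : Omega K (n + 1)) {b : Omega K m}
    (hb : b ∈ grade K m j) {a' : Omega K (n + 1)} (ha' : a' ∈ grade K (n + 1) i) (b' : Omega K m) :
    (a ᵍ⊗ₜ[K] b * a' ᵍ⊗ₜ[K] b' : HatOmega K n m) =
      (-1 : ℤˣ) ^ (j * i) • ((a * a') ᵍ⊗ₜ[K] (b * b') : HatOmega K n m) :=
  GradedTensorProduct.tmul_coe_mul_coe_tmul (grade K (n + 1)) (grade K m) a ⟨b, hb⟩ ⟨a', ha'⟩ b'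

variable (K) in
/-- Polynomial functions on `Δ̂ⁿ × Δᵐ` as forms. -/
def hatPoly (n m : ℕ) :
    MvPolynomial (Fin (n + 1 + 1)) K ⊗[K] MvPolynomial (Fin (m + 1)) K →ₐ[K] HatOmega K n m :=
  Algebra.TensorProduct.lift
    ((GradedTensorProduct.includeLeft (grade K (n + 1)) (grade K m)).comp (poly (n + 1)))
    ((GradedTensorProduct.includeRight (grade K (n + 1)) (grade K m)).comp (poly m))
    (fun p q => by
      change (poly (n + 1) p ᵍ⊗ₜ[K] (1 : Omega K m) * (1 : Omega K (n + 1)) ᵍ⊗ₜ[K] poly m q :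
        HatOmega K n m) = (1 : Omega K (n + 1)) ᵍ⊗ₜ[K] poly m q * poly (n + 1) p ᵍ⊗ₜ[K] 1
      rw [tmul_mul_tmul_of_mem _ (poly_mem q) (poly_mem p),
        tmul_mul_tmul_of_mem _ SetLike.GradedOne.one_mem SetLike.GradedOne.one_mem]
      simp)

/-- The pull-back of `xⱼ` along `((s, t), v) ↦ s v + ∑ᵢ tᵢ e_{f(i)}`, namely
`s xⱼ + ∑_{f(i) = j} tᵢ`. -/
def hatX {n m : ℕ} (f : Fin (n + 1) → Fin (m + 1)) (j : Fin (m + 1)) :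
    MvPolynomial (Fin (n + 1 + 1)) K ⊗[K] MvPolynomial (Fin (m + 1)) K :=
  MvPolynomial.X 0 ⊗ₜ MvPolynomial.X j + (∑ i with f i = j, MvPolynomial.X i.succ) ⊗ₜ 1

/-- The pull-back of `dxⱼ` along `((s, t), v) ↦ s v + ∑ᵢ tᵢ e_{f(i)}`, namely
`ds ⊗ xⱼ + s ⊗ dxⱼ + ∑_{f(i) = j} dtᵢ ⊗ 1`. -/
def hatDX {n m : ℕ} (f : Fin (n + 1) → Fin (m + 1)) (j : Fin (m + 1)) : HatOmega K n m :=
  dx K (0 : Fin (n + 1 + 1)) ᵍ⊗ₜ[K] x K j + x K (0 : Fin (n + 1 + 1)) ᵍ⊗ₜ[K] dx K j +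
    (∑ i with f i = j, dx K i.succ) ᵍ⊗ₜ[K] 1

theorem covec_anticomm {n : ℕ} (v w : Fin (n + 1) → K) :
    covec n v * covec n w = - (covec n w * covec n v) := by
  have h := covec_sq (v + w)
  rw [map_add, mul_add, add_mul, add_mul, covec_sq, covec_sq, zero_add, add_zero] at h
  exact eq_neg_of_add_eq_zero_right h

/-- Anticommutation of two pure tensors, for factors which commute up to sign. -/
theorem tmul_anticomm {n m p q p' q' : ℕ} {a a' : Omega K (n + 1)} {b b' : Omega K m}
    (ha : a ∈ grade K (n + 1) p) (hb : b ∈ grade K m q)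
    (ha' : a' ∈ grade K (n + 1) p') (hb' : b' ∈ grade K m q') {u v : ℤˣ}
    (haa : a * a' = u • (a' * a)) (hbb : b * b' = v • (b' * b))
    (h : (-1 : ℤˣ) ^ (q * p') * (u * v) = - (-1 : ℤˣ) ^ (q' * p)) :
    (a ᵍ⊗ₜ[K] b * a' ᵍ⊗ₜ[K] b' : HatOmega K n m) = - (a' ᵍ⊗ₜ[K] b' * a ᵍ⊗ₜ[K] b) := by
  rw [tmul_mul_tmul_of_mem _ hb ha', tmul_mul_tmul_of_mem _ hb' ha, haa, hbb]
  have e : ∀ (y : Omega K (n + 1)) (z : Omega K m),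
      ((u • y) ᵍ⊗ₜ[K] (v • z) : HatOmega K n m) = (u * v) • (y ᵍ⊗ₜ[K] z) := by
    intro y z
    have e1 : (-y) ⊗ₜ[K] z = - (y ⊗ₜ[K] z) := TensorProduct.neg_tmul _ _
    have e2 : y ⊗ₜ[K] (-z) = - (y ⊗ₜ[K] z) := TensorProduct.tmul_neg _ _
    have e3 : (-y) ⊗ₜ[K] (-z) = y ⊗ₜ[K] z := by
      rw [TensorProduct.tmul_neg, TensorProduct.neg_tmul, neg_neg]
    rcases Int.units_eq_one_or u with rfl | rfl <;> rcases Int.units_eq_one_or v with rfl | rfl <;>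
      simp [GradedTensorProduct.tmul, e1, e2, e3]
  rw [e, smul_smul, h, Units.neg_smul]

theorem hatDX_anticomm {n m : ℕ} (f : Fin (n + 1) → Fin (m + 1)) (i j : Fin (m + 1)) :
    (hatDX f i * hatDX f j : HatOmega K n m) = - (hatDX f j * hatDX f i) := by
  have hs : ∀ j, (∑ i with f i = j, dx K i.succ : Omega K (n + 1)) =
      covec (n + 1) (∑ i with f i = j, (Pi.single i.succ (1 : K) : Fin (n + 1 + 1) → K)) := by
    intro j; rw [map_sum]; rfl
  have hxx : ∀ {l : ℕ} (p q : MvPolynomial (Fin (l + 1)) K),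
      poly l p * poly l q = (1 : ℤˣ) • (poly l q * poly l p) := by
    intro l p q; rw [(poly_commute p _).eq, one_smul]
  have hxd : ∀ {l : ℕ} (p : MvPolynomial (Fin (l + 1)) K) (v : Fin (l + 1) → K),
      poly l p * covec l v = (1 : ℤˣ) • (covec l v * poly l p) := by
    intro l p v; rw [(poly_commute p _).eq, one_smul]
  have hdx : ∀ {l : ℕ} (v : Fin (l + 1) → K) (p : MvPolynomial (Fin (l + 1)) K),
      covec l v * poly l p = (1 : ℤˣ) • (poly l p * covec l v) := by
    intro l v p; rw [(poly_commute p _).eq, one_smul]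
  have hdd : ∀ {l : ℕ} (v w : Fin (l + 1) → K),
      covec l v * covec l w = (-1 : ℤˣ) • (covec l w * covec l v) := by
    intro l v w; rw [covec_anticomm v w, Units.neg_smul, one_smul]
  -- the three kinds of summands
  have hAA := fun (u v u' v') => tmul_anticomm (covec_mem u) (poly_mem v) (covec_mem u')
    (poly_mem v') (hdd (l := n + 1) _ _) (hxx (l := m) _ _) (by decide)
  have hAB := fun (u v u' v') => tmul_anticomm (covec_mem u) (poly_mem v) (poly_mem u')
    (covec_mem v') (hdx (l := n + 1) _ _) (hxd (l := m) _ _) (by decide)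
  have hBB := fun (u v u' v') => tmul_anticomm (poly_mem u) (covec_mem v) (poly_mem u')
    (covec_mem v') (hxx (l := n + 1) _ _) (hdd (l := m) _ _) (by decide)
  have expand : ∀ j, (hatDX f j : HatOmega K n m) =
      covec (n + 1) (Pi.single 0 1) ᵍ⊗ₜ[K] poly m (MvPolynomial.X j) +
      poly (n + 1) (MvPolynomial.X 0) ᵍ⊗ₜ[K] covec m (Pi.single j 1) +
      covec (n + 1) (∑ i with f i = j, (Pi.single i.succ (1 : K) : Fin (n + 1 + 1) → K)) ᵍ⊗ₜ[K]
        poly m 1 := by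
    intro j
    rw [hatDX, hs, map_one (poly (K := K) m), poly_X, poly_X, covec_single, covec_single]
  rw [expand i, expand j]
  generalize (∑ k with f k = i, (Pi.single k.succ (1 : K) : Fin (n + 1 + 1) → K)) = a
  generalize (∑ k with f k = j, (Pi.single k.succ (1 : K) : Fin (n + 1 + 1) → K)) = b
  simp only [mul_add, add_mul]
  rw [hAA (Pi.single 0 1) (MvPolynomial.X i) (Pi.single 0 1) (MvPolynomial.X j),
    hAA (Pi.single 0 1) (MvPolynomial.X i) b 1, hAA a 1 (Pi.single 0 1) (MvPolynomial.X j),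
    hAA a 1 b 1,
    hAB (Pi.single 0 1) (MvPolynomial.X i) (MvPolynomial.X 0) (Pi.single j 1),
    hAB a 1 (MvPolynomial.X 0) (Pi.single j 1),
    hAB (Pi.single 0 1) (MvPolynomial.X j) (MvPolynomial.X 0) (Pi.single i 1),
    hAB b 1 (MvPolynomial.X 0) (Pi.single i 1),
    hBB (MvPolynomial.X 0) (Pi.single i 1) (MvPolynomial.X 0) (Pi.single j 1)]
  abel

theorem hatPoly_tmul {n m : ℕ} (p : MvPolynomial (Fin (n + 1 + 1)) K)
    (q : MvPolynomial (Fin (m + 1)) K) :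
    hatPoly K n m (p ⊗ₜ q) = poly (n + 1) p ᵍ⊗ₜ[K] poly m q := by
  rw [hatPoly, Algebra.TensorProduct.lift_tmul, AlgHom.comp_apply, AlgHom.comp_apply,
    GradedTensorProduct.includeLeft_apply, GradedTensorProduct.includeRight_apply,
    GradedTensorProduct.tmul_one_mul_one_tmul]

theorem hatPoly_commute_tmul {n m i j : ℕ}
    (z : MvPolynomial (Fin (n + 1 + 1)) K ⊗[K] MvPolynomial (Fin (m + 1)) K)
    {a : Omega K (n + 1)} (ha : a ∈ grade K (n + 1) i) {b : Omega K m} (hb : b ∈ grade K m j) :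
    Commute (hatPoly K n m z) (a ᵍ⊗ₜ[K] b) := by
  induction z using TensorProduct.induction_on with
  | zero => rw [map_zero]; exact Commute.zero_left _
  | add y z hy hz => rw [map_add]; exact hy.add_left hz
  | tmul p q =>
    rw [hatPoly_tmul, Commute, SemiconjBy, tmul_mul_tmul_of_mem _ (poly_mem q) ha,
      tmul_mul_tmul_of_mem _ hb (poly_mem p), (poly_commute p a).eq, (poly_commute q b).eq,
      zero_mul, mul_zero]

theorem hatPoly_commute_hatDX {n m : ℕ} (f : Fin (n + 1) → Fin (m + 1)) (j : Fin (m + 1))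
    (z : MvPolynomial (Fin (n + 1 + 1)) K ⊗[K] MvPolynomial (Fin (m + 1)) K) :
    Commute (hatPoly K n m z) (hatDX f j) :=
  ((hatPoly_commute_tmul z (dx_mem _) (x_mem _)).add_right
    (hatPoly_commute_tmul z (x_mem _) (dx_mem _))).add_right
    (hatPoly_commute_tmul z (Submodule.sum_mem _ fun _ _ => dx_mem _) SetLike.GradedOne.one_mem)

/-- The pull-back of polynomials along `((s, t), v) ↦ s v + ∑ᵢ tᵢ e_{f(i)}`. -/
def hatPullPoly {n m : ℕ} (f : Fin (n + 1) → Fin (m + 1)) :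
    MvPolynomial (Fin (m + 1)) K →ₐ[K] HatOmega K n m :=
  (hatPoly K n m).comp (MvPolynomial.aeval (hatX f))

/-- The pull-back of covectors along `((s, t), v) ↦ s v + ∑ᵢ tᵢ e_{f(i)}`. -/
def hatPullCovec {n m : ℕ} (f : Fin (n + 1) → Fin (m + 1)) :
    (Fin (m + 1) → K) →ₗ[K] HatOmega K n m :=
  Fintype.linearCombination K (hatDX f)

theorem hatPullCovec_apply {n m : ℕ} (f : Fin (n + 1) → Fin (m + 1)) (v : Fin (m + 1) → K) :
    hatPullCovec f v = ∑ j, v j • (hatDX f j : HatOmega K n m) := rfl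

theorem hatPullCovec_single {n m : ℕ} (f : Fin (n + 1) → Fin (m + 1)) (j : Fin (m + 1)) :
    hatPullCovec f (Pi.single j (1 : K)) = hatDX f j := by
  rw [hatPullCovec, Fintype.linearCombination_apply_single, one_smul]

theorem hatPullCovec_sq [CharZero K] {n m : ℕ} (f : Fin (n + 1) → Fin (m + 1))
    (v : Fin (m + 1) → K) : hatPullCovec f v * hatPullCovec f v = 0 := by
  have h : hatPullCovec f v * hatPullCovec f v = - (hatPullCovec f v * hatPullCovec f v) := by
    conv_lhs => rw [hatPullCovec_apply, Finset.sum_mul_sum, Finset.sum_comm]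
    rw [hatPullCovec_apply, Finset.sum_mul_sum, ← Finset.sum_neg_distrib]
    refine Finset.sum_congr rfl fun i _ => ?_
    rw [← Finset.sum_neg_distrib]
    refine Finset.sum_congr rfl fun j _ => ?_
    rw [smul_mul_smul_comm, smul_mul_smul_comm, hatDX_anticomm f j i, smul_neg, mul_comm (v j)]
  have h2 : (2 : K) • (hatPullCovec f v * hatPullCovec f v) = 0 := by
    rw [two_smul]
    exact add_eq_zero_iff_eq_neg.2 h
  exact (smul_eq_zero.1 h2).resolve_left two_ne_zero

theorem hatPull_commute {n m : ℕ} (f : Fin (n + 1) → Fin (m + 1))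
    (q : MvPolynomial (Fin (m + 1)) K) (v : Fin (m + 1) → K) :
    Commute (hatPullPoly f q : HatOmega K n m) (hatPullCovec f v) := by
  rw [hatPullCovec_apply, hatPullPoly, AlgHom.comp_apply]
  exact Commute.sum_right _ _ _ fun j _ => (hatPoly_commute_hatDX f j _).smul_right _

theorem tmul_sum_right {n m : ℕ} {ι : Type*} (s : Finset ι) (a : Omega K (n + 1))
    (b : ι → Omega K m) :
    ∑ i ∈ s, (a ᵍ⊗ₜ[K] b i : HatOmega K n m) = a ᵍ⊗ₜ[K] (∑ i ∈ s, b i) := by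
  rw [GradedTensorProduct.tmul, TensorProduct.tmul_sum, map_sum]

theorem tmul_sum_left {n m : ℕ} {ι : Type*} (s : Finset ι) (a : ι → Omega K (n + 1))
    (b : Omega K m) :
    ∑ i ∈ s, (a i ᵍ⊗ₜ[K] b : HatOmega K n m) = (∑ i ∈ s, a i) ᵍ⊗ₜ[K] b := by
  rw [GradedTensorProduct.tmul, TensorProduct.sum_tmul, map_sum]

theorem hatPullPoly_sum {n m : ℕ} (f : Fin (n + 1) → Fin (m + 1)) :
    (hatPullPoly f (∑ j, MvPolynomial.X j : MvPolynomial (Fin (m + 1)) K) : HatOmega K n m) = 1 := by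
  rw [hatPullPoly, AlgHom.comp_apply, map_sum]
  simp only [MvPolynomial.aeval_X, hatX]
  rw [Finset.sum_add_distrib, ← TensorProduct.tmul_sum, ← TensorProduct.sum_tmul,
    Finset.sum_fiberwise, map_add, hatPoly_tmul, hatPoly_tmul, poly_sum, map_one,
    map_sum, ← tmul_sum_left, ← Fin.sum_univ_succ
      (fun i => (poly (n + 1) (MvPolynomial.X i : MvPolynomial (Fin (n + 1 + 1)) K) ᵍ⊗ₜ[K]
        (1 : Omega K m) : HatOmega K n m)), tmul_sum_left, ← map_sum, poly_sum]
  rfl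

theorem hatPullCovec_sum {n m : ℕ} (f : Fin (n + 1) → Fin (m + 1)) :
    ∑ j, (hatPullCovec f (Pi.single j (1 : K)) : HatOmega K n m) = 0 := by
  simp only [hatPullCovec_single, hatDX]
  rw [Finset.sum_add_distrib, Finset.sum_add_distrib, tmul_sum_right, tmul_sum_right,
    tmul_sum_left, Finset.sum_fiberwise]
  have h1 : ∑ j, x K j = (1 : Omega K m) := (map_sum (poly m) _ _).symm.trans poly_sum
  have h2 : ∑ j, dx K j = (0 : Omega K m) := covec_sum
  have h3 : ∑ j, dx K j = (0 : Omega K (n + 1)) := covec_sum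
  have h4 : (x K 0 ᵍ⊗ₜ[K] (0 : Omega K m) : HatOmega K n m) = 0 := by
    rw [GradedTensorProduct.tmul, TensorProduct.tmul_zero, map_zero]
  rw [h1, h2, h4, add_zero, ← tmul_sum_left, ← Fin.sum_univ_succ
    (fun i => (dx K i ᵍ⊗ₜ[K] (1 : Omega K m) : HatOmega K n m)), tmul_sum_left, h3,
    GradedTensorProduct.tmul, TensorProduct.zero_tmul, map_zero]

/-- The pull-back along `f̂ : Δ̂ⁿ × Δᵐ → Δᵐ`, `((s, t₀, …, tₙ), v) ↦ s v + ∑ᵢ tᵢ e_{f(i)}`. -/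
def hatPull [CharZero K] {n m : ℕ} (f : Fin (n + 1) → Fin (m + 1)) :
    Omega K m →ₐ[K] HatOmega K n m :=
  lift (K := K) (n := m) (B := HatOmega K n m) (hatPullPoly f) (hatPullCovec f)
    (hatPullCovec_sq (K := K) f) (hatPull_commute (K := K) f) (hatPullPoly_sum (K := K) f)
    (hatPullCovec_sum (K := K) f)

theorem hatPull_x [CharZero K] {n m : ℕ} (f : Fin (n + 1) → Fin (m + 1)) (j : Fin (m + 1)) :
    (hatPull f (x K j) : HatOmega K n m) =
      x K 0 ᵍ⊗ₜ[K] x K j + (∑ i with f i = j, x K i.succ) ᵍ⊗ₜ[K] 1 := by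
  rw [← poly_X, hatPull, lift_poly, hatPullPoly, AlgHom.comp_apply, MvPolynomial.aeval_X, hatX,
    map_add, hatPoly_tmul, hatPoly_tmul, map_one, map_sum]
  rfl

theorem hatPull_dx [CharZero K] {n m : ℕ} (f : Fin (n + 1) → Fin (m + 1)) (j : Fin (m + 1)) :
    (hatPull f (dx K j) : HatOmega K n m) = hatDX f j := by
  rw [← covec_single, hatPull, lift_covec, hatPullCovec_single]

/-! ### Whitney forms and the operators -/

/-- The Whitney elementary form
`ω_f = n! ∑ᵢ (-1)^i x_{f(i)} dx_{f(0)} ∧ ⋯ ∧ (omit dx_{f(i)}) ∧ ⋯ ∧ dx_{f(n)}`. -/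
def whitney (K : Type*) [Field K] {n m : ℕ} (f : Fin (n + 1) → Fin (m + 1)) : Omega K m :=
  (n.factorial : K) • ∑ i : Fin (n + 1), (-1 : K) ^ (i : ℕ) •
    (x K (f i) * (List.ofFn fun j : Fin n => dx K (f (i.succAbove j))).prod)

/-- The space `Cₘ` of Whitney elementary forms. -/
def whitneySpace (K : Type*) [Field K] (m : ℕ) : Submodule K (Omega K m) :=
  Submodule.span K {ω | ∃ (n : ℕ) (f : Fin (n + 1) →o Fin (m + 1)), ω = whitney K f}

instance (n m : ℕ) : Fintype (Fin (n + 1) ↪o Fin (m + 1)) := Fintype.ofFinite _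

section Operators

variable (K) [CharZero K]

/-- Whitney's map `πₘ(η) = ∑ₙ ∑_{f ∈ I(n, m)} (∫_{Δⁿ} f^*η) ω_f`. -/
def whitneyProj (m : ℕ) : Omega K m →ₗ[K] Omega K m :=
  ∑ n ∈ Finset.range (m + 1), ∑ f : Fin (n + 1) ↪o Fin (m + 1),
    (integral K n ∘ₗ (pullback f).toLinearMap).smulRight (whitney K f)

/-- The operator `k_f = (∫_{Δ̂ⁿ} ⊗ Id) ∘ f̂^*`. -/
def manettiFace {n m : ℕ} (f : Fin (n + 1) → Fin (m + 1)) : Omega K m →ₗ[K] Omega K m :=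
  (TensorProduct.lid K (Omega K m)).toLinearMap ∘ₗ
    (integral K (n + 1)).rTensor (Omega K m) ∘ₗ
    (GradedTensorProduct.of K (grade K (n + 1)) (grade K m)).symm.toLinearMap ∘ₗ
    (hatPull f).toLinearMap

/-- Manetti's operator `kₘ(η) = ∑ₙ ∑_{f ∈ I(n, m)} ω_f ∧ k_f(η)`. -/
def manetti (m : ℕ) : Omega K m →ₗ[K] Omega K m :=
  ∑ n ∈ Finset.range (m + 1), ∑ f : Fin (n + 1) ↪o Fin (m + 1),
    LinearMap.mulLeft K (whitney K f) ∘ₗ manettiFace K f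

end Operators

/-! ### Contractions

All DG-vector spaces that occur are concentrated in nonnegative degrees, so gradings are
indexed by `ℕ`. -/

section Contraction

/-- `(V, 𝒱, d)` is a DG-vector space. -/
structure IsDG {V : Type*} [AddCommGroup V] [Module K V] (𝒱 : ℕ → Submodule K V)
    (d : V →ₗ[K] V) : Prop where
  isInternal : DirectSum.IsInternal 𝒱
  map_mem : ∀ p, ∀ v ∈ 𝒱 p, d v ∈ 𝒱 (p + 1)
  comp_self : d ∘ₗ d = 0

/-- `f` is a morphism of DG-vector spaces. -/
structure IsDGHom {V W : Type*} [AddCommGroup V] [Module K V] [AddCommGroup W] [Module K W]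
    (𝒱 : ℕ → Submodule K V) (dV : V →ₗ[K] V) (𝒲 : ℕ → Submodule K W) (dW : W →ₗ[K] W)
    (f : V →ₗ[K] W) : Prop where
  map_mem : ∀ p, ∀ v ∈ 𝒱 p, f v ∈ 𝒲 p
  comm : f ∘ₗ dV = dW ∘ₗ f

/-- `M ⇄ N` with maps `i : M → N`, `π : N → M` and `h ∈ Hom⁻¹(N, N)` is a contraction. -/
structure IsContraction {M N : Type*} [AddCommGroup M] [Module K M] [AddCommGroup N] [Module K N]
    (𝓜 : ℕ → Submodule K M) (dM : M →ₗ[K] M) (𝓝 : ℕ → Submodule K N) (dN : N →ₗ[K] N)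
    (i : M →ₗ[K] N) (h : N →ₗ[K] N) (π : N →ₗ[K] M) : Prop where
  isDG_left : IsDG 𝓜 dM
  isDG_right : IsDG 𝓝 dN
  isDGHom_i : IsDGHom 𝓜 dM 𝓝 dN i
  isDGHom_π : IsDGHom 𝓝 dN 𝓜 dM π
  h_mem : ∀ p, ∀ v ∈ 𝓝 (p + 1), h v ∈ 𝓝 p
  h_zero : ∀ v ∈ 𝓝 0, h v = 0
  π_comp_i : π ∘ₗ i = LinearMap.id
  homotopy : i ∘ₗ π - LinearMap.id = dN ∘ₗ h + h ∘ₗ dN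

/-- A family of contractions with structure maps `g^*` indexed by the nondecreasing maps
`g : [p] → [m]` is a simplicial object in the category of contractions, in which a morphism
is a morphism `f` of the large DG-vector spaces with `f h = h f`, inducing `π f i` on the
small ones. -/
structure IsSimplicialContraction {M N : ℕ → Type*}
    [∀ m, AddCommGroup (M m)] [∀ m, Module K (M m)]
    [∀ m, AddCommGroup (N m)] [∀ m, Module K (N m)]
    (𝓜 : ∀ m, ℕ → Submodule K (M m)) (dM : ∀ m, M m →ₗ[K] M m)
    (mapM : ∀ {p m : ℕ}, (Fin (p + 1) →o Fin (m + 1)) → M m →ₗ[K] M p)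
    (𝓝 : ∀ m, ℕ → Submodule K (N m)) (dN : ∀ m, N m →ₗ[K] N m)
    (mapN : ∀ {p m : ℕ}, (Fin (p + 1) →o Fin (m + 1)) → N m →ₗ[K] N p)
    (i : ∀ m, M m →ₗ[K] N m) (h : ∀ m, N m →ₗ[K] N m) (π : ∀ m, N m →ₗ[K] M m) : Prop where
  isContraction : ∀ m, IsContraction (𝓜 m) (dM m) (𝓝 m) (dN m) (i m) (h m) (π m)
  map_id : ∀ m, mapN (OrderHom.id : Fin (m + 1) →o Fin (m + 1)) = LinearMap.id
  map_comp : ∀ {q p m : ℕ} (g : Fin (p + 1) →o Fin (m + 1)) (f : Fin (q + 1) →o Fin (p + 1)),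
    mapN (g.comp f) = mapN f ∘ₗ mapN g
  isDGHom_map : ∀ {p m : ℕ} (g : Fin (p + 1) →o Fin (m + 1)),
    IsDGHom (𝓝 m) (dN m) (𝓝 p) (dN p) (mapN g)
  map_h : ∀ {p m : ℕ} (g : Fin (p + 1) →o Fin (m + 1)), mapN g ∘ₗ h m = h p ∘ₗ mapN g
  map_hat : ∀ {p m : ℕ} (g : Fin (p + 1) →o Fin (m + 1)), mapM g = π p ∘ₗ mapN g ∘ₗ i m

end Contraction

end PolyForm

end

/-! The homotopy comes from integration along the fibres of a join. For `f` of dimension n, the map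
f̂ joins a point v of Δᵐ to the face f. On the facet s = 0 it is the face inclusion and does not see
v. On the facet t_i = 0 it is the join map of the face f∘δ_i, where δ_i skips i; if n = 0 that facet
is the single point s = 1, where f̂ is the identity in v. Since f̂^* is a chain map
(`totalD_hatTensor`), Stokes' formula along Δ̂ⁿ (`integral_d`, `fiberIntegral_totalD`) yields
k_f(dη) = (∫ f^*η)·1 − ∑ (−1)^i k_{f∘δ_i}(η) − (−1)^n d k_f(η), with η in place of the sum when n =
0 (`manettiFace_d_zero`, `manettiFace_d_succ`).

Multiply by ω_f, which has degree n: by the Leibniz rule the last term cancels against part of d(ω_f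
k_f(η)), leaving dω_f ∧ k_f(η). Whitney forms satisfy dω_f = ∑_k ω_{(k,f)} (`d_whitney`), so summing
these terms over the n-dimensional faces gives exactly the sum of (−1)^i ω_g k_{g∘δ_i}(η) over the
faces g of dimension n + 1 (`sum_d_whitney_mul`). The boundary terms therefore telescope
(`sum_homotopy`). At the bottom, −η remains because the vertex forms add up to 1; at the top nothing
remains because there is no strictly increasing map [m+1] → [m]. This is the homotopy formula.

Naturality rests on three facts: k_h g^* = g^* k_{g∘h} because g is affine (`manettiFace_pullback`),
g^*ω_f is the sum of ω_h over all h with g∘h = f (`pullback_whitney`), and k_f = 0 for non-injective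
f (`manettiFace_of_not_injective`). The last fact disposes of the faces which g collapses.

That π is a projector is the duality ∫ g^*ω_f = δ_{fg} (`integral_pullback_whitney`). The rest is
formal: π = Id + kd + dk commutes with d, so its image is stable under d. -/

noncomputable section

namespace PolyForm

/-! ### Differential calculus on Ω: induction on generators, Leibniz rule, sign involution,
pull-backs. -/

section Calculus

variable {K : Type*} [Field K]

theorem covec_eq_sum {n : ℕ} (v : Fin (n + 1) → K) : covec n v = ∑ i, v i • dx K i := by
  conv_lhs => rw [pi_eq_sum_univ' v, map_sum]
  simp only [map_smul, ← covec_single]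

/-- Induction on homogeneous forms: products of coordinates and their differentials. -/
theorem grade_induction {n : ℕ} {P : ℕ → Omega K n → Prop} (one : P 0 1)
    (zero : ∀ p, P p 0) (add : ∀ p a b, P p a → P p b → P p (a + b))
    (smul : ∀ p (c : K) a, P p a → P p (c • a))
    (x_mul : ∀ p i a, P p a → P p (x K i * a))
    (dx_mul : ∀ p i a, P p a → P (p + 1) (dx K i * a))
    {p : ℕ} {a : Omega K n} (ha : a ∈ grade K n p) : P p a := by
  have sum : ∀ p (s : Finset (Fin (n + 1))) (u : Fin (n + 1) → Omega K n),
      (∀ i, P p (u i)) → P p (∑ i ∈ s, u i) := fun p s u hu =>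
    Finset.sum_induction _ (P p) (fun a b => add p a b) (zero p) fun i _ => hu i
  induction ha using Submodule.span_induction with
  | zero => exact zero p
  | add a b _ _ h1 h2 => exact add p a b h1 h2
  | smul c a _ h => exact smul p c a h
  | mem η h =>
    obtain ⟨q, w, hw, rfl⟩ := h
    rw [mk_tmul]
    have hw' : P p (mk K n (1 ⊗ₜ w)) := by
      clear q
      induction hw using Submodule.pow_induction_on_left' with
      | algebraMap r =>
        rw [Algebra.algebraMap_eq_smul_one, TensorProduct.tmul_smul, map_smul,
          ← Algebra.TensorProduct.one_def, map_one (mk K n)]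
        exact smul _ _ _ one
      | add a b i ha hb iha ihb =>
        rw [TensorProduct.tmul_add, map_add]
        exact add _ _ _ iha ihb
      | mem_mul m hm i a ha iha =>
        obtain ⟨v, rfl⟩ := hm
        rw [mk_one_tmul_ι_mul, covec_eq_sum, Finset.sum_mul]
        refine sum _ _ _ fun j => ?_
        rw [smul_mul_assoc]
        exact smul _ _ _ (dx_mul _ _ _ iha)
    generalize mk K n (1 ⊗ₜ w) = η at hw'
    induction q using MvPolynomial.induction_on generalizing η with
    | C r =>
      rw [← MvPolynomial.algebraMap_eq, AlgHom.commutes, ← Algebra.smul_def]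
      exact smul _ _ _ hw'
    | add a b ha hb => rw [map_add, add_mul]; exact add _ _ _ (ha _ hw') (hb _ hw')
    | mul_X a i ha =>
      rw [map_mul, poly_X, mul_assoc]
      exact ha _ (x_mul _ _ _ hw')

/-- Induction on forms: products of coordinates and their differentials. -/
theorem omega_induction {n : ℕ} {P : Omega K n → Prop} (one : P 1)
    (add : ∀ a b, P a → P b → P (a + b)) (smul : ∀ (c : K) a, P a → P (c • a))
    (x_mul : ∀ i a, P a → P (x K i * a)) (dx_mul : ∀ i a, P a → P (dx K i * a))
    (a : Omega K n) : P a := by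
  have zero : P 0 := by simpa using smul 0 1 one
  refine DirectSum.Decomposition.inductionOn (grade K n) zero (fun {i} a => ?_) add a
  exact grade_induction (P := fun _ => P) one (fun _ => zero) (fun _ => add) (fun _ => smul)
    (fun _ => x_mul) (fun _ => dx_mul) a.2

/-- Two linear maps agree as soon as they agree after left multiplication by generators. -/
theorem linearMap_ext {n : ℕ} {V : Type*} [AddCommGroup V] [Module K V]
    {f g : Omega K n →ₗ[K] V} (one : f 1 = g 1)
    (x_mul : ∀ i a, f a = g a → f (x K i * a) = g (x K i * a))
    (dx_mul : ∀ i a, f a = g a → f (dx K i * a) = g (dx K i * a)) : f = g :=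
  LinearMap.ext fun a => omega_induction one (fun a b ha hb => by rw [map_add, map_add, ha, hb])
    (fun c a ha => by rw [map_smul, map_smul, ha]) x_mul dx_mul a

theorem x_mul_comm {n : ℕ} (i : Fin (n + 1)) (a : Omega K n) : x K i * a = a * x K i :=
  (poly_commute (MvPolynomial.X i) a).eq

theorem freeD_x_mul {n : ℕ} (i : Fin (n + 1)) (z : Free K n) :
    freeD K n (MvPolynomial.X i ⊗ₜ 1 * z) =
      1 ⊗ₜ ExteriorAlgebra.ι K (Pi.single i 1) * z + MvPolynomial.X i ⊗ₜ 1 * freeD K n z := by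
  induction z using TensorProduct.induction_on with
  | zero => simp
  | add a b ha hb => simp only [mul_add, map_add, ha, hb]; abel
  | tmul q w =>
    simp only [Algebra.TensorProduct.tmul_mul_tmul, one_mul, freeD_tmul, Finset.mul_sum,
      Derivation.leibniz, smul_eq_mul, MvPolynomial.pderiv_X, TensorProduct.add_tmul,
      Finset.sum_add_distrib]
    rw [add_comm]
    congr 1
    rw [Finset.sum_eq_single i]
    · simp
    · intro j _ hj; simp [Pi.single_eq_of_ne hj.symm]
    · simp

theorem freeD_ι_mul {n : ℕ} (v : Fin (n + 1) → K) (z : Free K n) :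
    freeD K n (1 ⊗ₜ ExteriorAlgebra.ι K v * z) =
      -(1 ⊗ₜ ExteriorAlgebra.ι K v * freeD K n z) := by
  induction z using TensorProduct.induction_on with
  | zero => simp
  | add a b ha hb => simp only [mul_add, map_add, ha, hb]; abel
  | tmul q w =>
    simp only [Algebra.TensorProduct.tmul_mul_tmul, one_mul, freeD_tmul, Finset.mul_sum,
      ← Finset.sum_neg_distrib]
    refine Finset.sum_congr rfl fun j _ => ?_
    rw [← TensorProduct.tmul_neg, ← mul_assoc, ← mul_assoc, ← neg_mul]
    congr 2
    exact eq_neg_of_add_eq_zero_left (ExteriorAlgebra.ι_add_mul_swap _ v)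

theorem d_one {n : ℕ} : d K n 1 = 0 := by
  rw [← map_one (mk K n), d_mk, Algebra.TensorProduct.one_def, freeD_tmul]
  simp

theorem d_x_mul {n : ℕ} (i : Fin (n + 1)) (a : Omega K n) :
    d K n (x K i * a) = dx K i * a + x K i * d K n a := by
  obtain ⟨z, rfl⟩ := mk_surjective n a
  rw [x, ← map_mul, d_mk, freeD_x_mul, map_add, map_mul, map_mul, d_mk]
  rfl

theorem d_covec_mul {n : ℕ} (v : Fin (n + 1) → K) (a : Omega K n) :
    d K n (covec n v * a) = -(covec n v * d K n a) := by
  obtain ⟨z, rfl⟩ := mk_surjective n a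
  have h := congrArg (mk K n) (freeD_ι_mul v z)
  rwa [map_neg, map_mul (mk K n), ← d_mk, map_mul (mk K n)] at h

theorem d_dx_mul {n : ℕ} (i : Fin (n + 1)) (a : Omega K n) :
    d K n (dx K i * a) = -(dx K i * d K n a) :=
  d_covec_mul _ a

theorem d_comp_d (n : ℕ) : d K n ∘ₗ d K n = 0 := by
  refine linearMap_ext ?_ ?_ ?_
  · simp [d_one]
  · intro i a h
    simp only [LinearMap.comp_apply, LinearMap.zero_apply] at h ⊢
    rw [d_x_mul, map_add, d_x_mul, d_dx_mul, h, mul_zero, add_zero, neg_add_cancel]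
  · intro i a h
    simp only [LinearMap.comp_apply, LinearMap.zero_apply] at h ⊢
    rw [d_dx_mul, map_neg, d_dx_mul, h, mul_zero, neg_zero, neg_zero]

theorem mul_mem_grade {n i j k : ℕ} {a b : Omega K n} (ha : a ∈ grade K n i)
    (hb : b ∈ grade K n j) (hk : i + j = k) : a * b ∈ grade K n k :=
  hk ▸ SetLike.mul_mem_graded ha hb

theorem one_mem_grade (n : ℕ) : (1 : Omega K n) ∈ grade K n 0 := SetLike.GradedOne.one_mem

theorem d_mem_grade {n p : ℕ} {a : Omega K n} (ha : a ∈ grade K n p) :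
    d K n a ∈ grade K n (p + 1) := by
  refine (grade_induction (P := fun p a => a ∈ grade K n p ∧ d K n a ∈ grade K n (p + 1))
    ?_ ?_ ?_ ?_ ?_ ?_ ha).2
  · exact ⟨one_mem_grade n, by rw [d_one]; exact zero_mem _⟩
  · intro p; simp
  · rintro p a b ⟨h1, h2⟩ ⟨h3, h4⟩
    exact ⟨add_mem h1 h3, by rw [map_add]; exact add_mem h2 h4⟩
  · rintro p c a ⟨h1, h2⟩
    exact ⟨Submodule.smul_mem _ _ h1, by rw [map_smul]; exact Submodule.smul_mem _ _ h2⟩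
  · rintro p i a ⟨h1, h2⟩
    refine ⟨mul_mem_grade (x_mem i) h1 (zero_add p), ?_⟩
    rw [d_x_mul]
    exact add_mem (mul_mem_grade (dx_mem i) h1 (add_comm _ _))
      (mul_mem_grade (x_mem i) h2 (zero_add _))
  · rintro p i a ⟨h1, h2⟩
    refine ⟨mul_mem_grade (dx_mem i) h1 (add_comm _ _), ?_⟩
    rw [d_dx_mul]
    exact neg_mem (mul_mem_grade (dx_mem i) h2 (add_comm _ _))

/-- The Leibniz rule with a homogeneous left factor. -/
theorem d_mul {n p : ℕ} {a : Omega K n} (ha : a ∈ grade K n p) (b : Omega K n) :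
    d K n (a * b) = d K n a * b + (-1 : K) ^ p • (a * d K n b) := by
  refine grade_induction
    (P := fun p a => d K n (a * b) = d K n a * b + (-1 : K) ^ p • (a * d K n b))
    ?_ ?_ ?_ ?_ ?_ ?_ ha
  · simp [d_one]
  · simp
  · intro p a a' h h'
    simp only [add_mul, map_add, h, h', smul_add]
    abel
  · intro p c a h
    rw [smul_mul_assoc, map_smul, h, map_smul, smul_add, smul_mul_assoc, smul_mul_assoc,
      smul_comm c]
  · intro p i a h
    rw [mul_assoc, d_x_mul, h, d_x_mul, mul_add, add_mul, mul_smul_comm]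
    simp only [mul_assoc]
    abel
  · intro p i a h
    rw [mul_assoc, d_dx_mul, h, d_dx_mul, mul_add, mul_smul_comm, pow_succ, mul_neg_one, neg_smul,
      neg_add, neg_mul]
    simp only [mul_assoc]

variable (K) in
/-- The grading involution, `(-1)^p` on `p`-forms. -/
def invol (n : ℕ) : Omega K n →ₐ[K] Omega K n :=
  lift (K := K) (n := n) (B := Omega K n) (poly n) (-covec n)
    (fun v => by simp [covec_sq]) (fun q v => poly_commute q _) poly_sum
    (by simp [covec_sum])

theorem invol_x {n : ℕ} (i : Fin (n + 1)) : invol K n (x K i) = x K i := by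
  rw [← poly_X, invol, lift_poly]

theorem invol_dx {n : ℕ} (i : Fin (n + 1)) : invol K n (dx K i) = -dx K i := by
  rw [← covec_single, invol, lift_covec, LinearMap.neg_apply]

theorem invol_of_mem {n p : ℕ} {a : Omega K n} (ha : a ∈ grade K n p) :
    invol K n a = (-1 : K) ^ p • a := by
  refine grade_induction (P := fun p a => invol K n a = (-1 : K) ^ p • a)
    ?_ ?_ ?_ ?_ ?_ ?_ ha
  · simp
  · simp
  · intro p a b h1 h2; rw [map_add, h1, h2, smul_add]
  · intro p c a h; rw [map_smul, h, smul_comm]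
  · intro p i a h; rw [map_mul, h, invol_x, mul_smul_comm]
  · intro p i a h
    rw [map_mul, h, invol_dx, mul_smul_comm, neg_mul, smul_neg, pow_succ, mul_neg_one, neg_smul]

theorem invol_invol {n : ℕ} (a : Omega K n) : invol K n (invol K n a) = a := by
  have : (invol K n).comp (invol K n) = AlgHom.id K _ := algHom_ext
    (fun i => by simp [invol_x]) (fun i => by simp [invol_dx])
  exact DFunLike.congr_fun this a

/-- The operator d raises the degree by one, hence anticommutes with the sign (−1)^p. This is what
makes the total differential on a tensor product carry the Koszul sign. -/
theorem d_invol {n : ℕ} (a : Omega K n) : d K n (invol K n a) = -invol K n (d K n a) := by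
  suffices h : d K n ∘ₗ (invol K n).toLinearMap = -((invol K n).toLinearMap ∘ₗ d K n) from
    LinearMap.congr_fun h a
  refine linearMap_ext ?_ ?_ ?_
  · simp [d_one]
  · intro i a h
    simp only [LinearMap.comp_apply, LinearMap.neg_apply, AlgHom.toLinearMap_apply] at h ⊢
    rw [map_mul, invol_x, d_x_mul, h, d_x_mul, map_add, map_mul, map_mul, invol_x, invol_dx,
      neg_add, neg_mul, neg_neg, mul_neg]
  · intro i a h
    simp only [LinearMap.comp_apply, LinearMap.neg_apply, AlgHom.toLinearMap_apply] at h ⊢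
    rw [map_mul, invol_dx, neg_mul, map_neg, d_dx_mul, h, d_dx_mul, map_neg, map_mul, invol_dx,
      neg_mul, mul_neg]

theorem integral_invol [CharZero K] {n : ℕ} (a : Omega K n) :
    integral K n (invol K n a) = (-1) ^ n * integral K n a := by
  refine DirectSum.Decomposition.inductionOn (grade K n) (by simp) (fun {i} a => ?_)
    (fun a b ha hb => by rw [map_add, map_add, ha, hb, map_add, mul_add]) a
  rw [invol_of_mem a.2, map_smul, smul_eq_mul]
  by_cases h : i = n
  · subst h; rfl
  · rw [integral_of_ne h a.2, mul_zero, mul_zero]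

/-! ### Pull-backs -/

theorem pullback_id {n : ℕ} : pullback (K := K) (id : Fin (n + 1) → Fin (n + 1)) = AlgHom.id K _ :=
  algHom_ext (fun i => by simp [pullback_x, Finset.filter_eq'])
    (fun i => by simp [pullback_dx, Finset.filter_eq'])

/-- The fibre of a composite is the union of the fibres of the inner map over the fibre of the outer
one. Pull-backs are defined by sums over fibres, so this is their functoriality. -/
theorem sum_filter_comp {α β γ V : Type*} [Fintype α] [Fintype β] [DecidableEq β] [DecidableEq γ]
    [AddCommMonoid V] (f : β → γ) (c : α → β) (u : α → V) (j : γ) :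
    ∑ i with (f ∘ c) i = j, u i = ∑ k with f k = j, ∑ i with c i = k, u i := by
  rw [← Finset.sum_fiberwise_of_maps_to (s := Finset.univ.filter fun i => (f ∘ c) i = j)
    (t := Finset.univ.filter fun k => f k = j) (g := c) (by simp)]
  refine Finset.sum_congr rfl fun k hk => Finset.sum_congr ?_ fun _ _ => rfl
  ext i
  simp only [Finset.mem_filter, Finset.mem_univ, true_and, Function.comp_apply] at hk ⊢
  exact ⟨fun h => h.2, fun h => ⟨by rw [h, hk], h⟩⟩

theorem pullback_comp {q p m : ℕ} (g : Fin (p + 1) → Fin (m + 1)) (f : Fin (q + 1) → Fin (p + 1)) :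
    pullback (K := K) (g ∘ f) = (pullback f).comp (pullback g) := by
  refine algHom_ext (fun j => ?_) (fun j => ?_)
  · simp only [AlgHom.comp_apply, pullback_x, map_sum, sum_filter_comp g f]
  · simp only [AlgHom.comp_apply, pullback_dx, map_sum, sum_filter_comp g f]

theorem pullback_d {n m : ℕ} (g : Fin (n + 1) → Fin (m + 1)) :
    (pullback (K := K) g).toLinearMap ∘ₗ d K m = d K n ∘ₗ (pullback g).toLinearMap := by
  refine linearMap_ext ?_ ?_ ?_
  · simp [d_one]
  · intro i a h
    simp only [LinearMap.comp_apply, AlgHom.toLinearMap_apply] at h ⊢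
    simp only [d_x_mul, map_add, map_mul, pullback_x, pullback_dx, Finset.sum_mul, map_sum, h,
      Finset.sum_add_distrib]
  · intro i a h
    simp only [LinearMap.comp_apply, AlgHom.toLinearMap_apply] at h ⊢
    simp only [d_dx_mul, map_neg, map_mul, pullback_dx, Finset.sum_mul, map_sum, h,
      Finset.sum_neg_distrib]

theorem pullback_invol {n m : ℕ} (g : Fin (n + 1) → Fin (m + 1)) (a : Omega K m) :
    pullback g (invol K m a) = invol K n (pullback g a) := by
  have : (pullback (K := K) g).comp (invol K m) = (invol K n).comp (pullback g) := algHom_ext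
    (fun i => by simp [pullback_x, invol_x]) (fun i => by simp [pullback_dx, invol_dx])
  exact DFunLike.congr_fun this a

theorem pullback_mem_grade {n m p : ℕ} (g : Fin (n + 1) → Fin (m + 1)) {a : Omega K m}
    (ha : a ∈ grade K m p) : pullback g a ∈ grade K n p := by
  refine grade_induction (P := fun p a => pullback g a ∈ grade K n p) ?_ ?_ ?_ ?_ ?_ ?_ ha
  · rw [map_one]; exact one_mem_grade n
  · simp
  · intro p a b h1 h2; rw [map_add]; exact add_mem h1 h2
  · intro p c a h; rw [map_smul]; exact Submodule.smul_mem _ _ h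
  · intro p i a h
    rw [map_mul, pullback_x]
    exact mul_mem_grade (sum_mem fun i _ => x_mem i) h (zero_add p)
  · intro p i a h
    rw [map_mul, pullback_dx]
    exact mul_mem_grade (sum_mem fun i _ => dx_mem i) h (add_comm _ _)

end Calculus

/-! ### Integration: determinants, degenerate maps and Stokes' formula on the simplex. -/

section Integration

variable {K : Type*} [Field K]

variable (K) in
/-- The product of `p` covectors, as a constant form. -/
def wedge (m p : ℕ) : (Fin (m + 1) → K) [⋀^Fin p]→ₗ[K] Omega K m :=
  ((mk K m).toLinearMap ∘ₗ (Algebra.TensorProduct.includeRight (R := K)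
    (A := MvPolynomial (Fin (m + 1)) K)).toLinearMap).compAlternatingMap (ExteriorAlgebra.ιMulti K p)

theorem wedge_eq_mk {m p : ℕ} (v : Fin p → Fin (m + 1) → K) :
    wedge K m p v = mk K m (1 ⊗ₜ ExteriorAlgebra.ιMulti K p v) := rfl

theorem wedge_apply {m p : ℕ} (v : Fin p → Fin (m + 1) → K) :
    wedge K m p v = (List.ofFn fun i => covec m (v i)).prod := by
  rw [wedge_eq_mk, ExteriorAlgebra.ιMulti_apply]
  have h := map_list_prod ((mk K m).comp (Algebra.TensorProduct.includeRight (R := K)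
    (A := MvPolynomial (Fin (m + 1)) K))) (List.ofFn fun i => ExteriorAlgebra.ι K (v i))
  rwa [List.map_ofFn] at h

theorem wedge_cons {m p : ℕ} (u : Fin (m + 1) → K) (v : Fin p → Fin (m + 1) → K) :
    wedge K m (p + 1) (Fin.cons u v) = covec m u * wedge K m p v := by
  simp [wedge_apply, List.ofFn_succ]

theorem wedge_mem {m p : ℕ} (v : Fin p → Fin (m + 1) → K) : wedge K m p v ∈ grade K m p :=
  Submodule.subset_span ⟨1, _, ExteriorAlgebra.ιMulti_range K p ⟨v, rfl⟩, rfl⟩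

theorem pullback_covec {n m : ℕ} (g : Fin (n + 1) → Fin (m + 1)) (v : Fin (m + 1) → K) :
    pullback g (covec m v) = covec n (v ∘ g) := by
  rw [pullback, lift_covec]; rfl

theorem pullback_wedge {n m p : ℕ} (g : Fin (n + 1) → Fin (m + 1)) (v : Fin p → Fin (m + 1) → K) :
    pullback g (wedge K m p v) = wedge K n p fun i => v i ∘ g := by
  simp only [wedge_apply, map_list_prod, List.map_ofFn, Function.comp_def, pullback_covec]

theorem pullback_poly {n m : ℕ} (g : Fin (n + 1) → Fin (m + 1))
    (q : MvPolynomial (Fin (m + 1)) K) :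
    pullback g (poly m q) =
      poly n (MvPolynomial.aeval (fun j => ∑ i with g i = j, MvPolynomial.X i) q) := by
  rw [pullback, lift_poly]; rfl

theorem linearMap_ext_poly_mul_wedge {n : ℕ} {V : Type*} [AddCommGroup V] [Module K V]
    {f g : Omega K n →ₗ[K] V}
    (h : ∀ p q v, f (poly n q * wedge K n p v) = g (poly n q * wedge K n p v)) : f = g := by
  ext a
  obtain ⟨z, rfl⟩ := mk_surjective n a
  induction z using TensorProduct.induction_on with
  | zero => simp
  | add a b ha hb => simp only [map_add, ha, hb]
  | tmul q w =>
    have hw : w ∈ Submodule.span K (Set.range fun x : Σ p, (Fin p → Fin (n + 1) → K) =>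
        ExteriorAlgebra.ιMulti K x.1 x.2) := by
      rw [ExteriorAlgebra.ιMulti_span]; trivial
    induction hw using Submodule.span_induction with
    | zero => simp
    | add a b _ _ ha hb => simp only [TensorProduct.tmul_add, map_add, ha, hb]
    | smul c a _ ha => simp only [TensorProduct.tmul_smul, map_smul, ha]
    | mem w hw =>
      obtain ⟨⟨p, v⟩, rfl⟩ := hw
      rw [mk_tmul]
      exact h p q v

theorem d_poly_mul_wedge {n p : ℕ} (q : MvPolynomial (Fin (n + 1)) K)
    (v : Fin p → Fin (n + 1) → K) :
    d K n (poly n q * wedge K n p v) =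
      ∑ i, poly n (MvPolynomial.pderiv i q) * wedge K n (p + 1) (Fin.cons (Pi.single i 1) v) := by
  rw [wedge_eq_mk, ← mk_tmul, d_mk, freeD_tmul, map_sum]
  refine Finset.sum_congr rfl fun i _ => ?_
  rw [mk_tmul, wedge_cons, mk_one_tmul_ι_mul]
  rfl

/-- The covector ∑ dx_i, which `orient` multiplies in on the left, has all its entries equal to 1,
so it becomes a first row of ones. -/
theorem orient_ιMulti {n : ℕ} (v : Fin n → Fin (n + 1) → K) :
    orient K n (ExteriorAlgebra.ιMulti K n v) = Matrix.det (Matrix.of (Fin.cons 1 v)) := by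
  have e : ExteriorAlgebra.ι K (1 : Fin (n + 1) → K) * ExteriorAlgebra.ιMulti K n v =
      ExteriorAlgebra.ιMulti K (n + 1) (Fin.cons 1 v) := by
    rw [ExteriorAlgebra.ιMulti_apply, ExteriorAlgebra.ιMulti_apply, List.ofFn_succ]; simp
  rw [orient, LinearMap.comp_apply, LinearMap.mulLeft_apply, ← map_sum, topCoeff,
    show ∑ i, Pi.single i (1 : K) = (1 : Fin (n + 1) → K) from Finset.univ_sum_single 1, e,
    ExteriorAlgebra.liftAlternating_apply_ιMulti, Pi.single_eq_same]
  rfl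

theorem integral_poly_mul_wedge [CharZero K] {n : ℕ} (q : MvPolynomial (Fin (n + 1)) K)
    (v : Fin n → Fin (n + 1) → K) :
    integral K n (poly n q * wedge K n n v) =
      moment K n q * Matrix.det (Matrix.of (Fin.cons 1 v)) := by
  rw [wedge_eq_mk, ← mk_tmul, integral_mk, freeIntegral_tmul, orient_ιMulti]

theorem integral_poly_mul_wedge_of_ne [CharZero K] {n p : ℕ} (hp : p ≠ n)
    (q : MvPolynomial (Fin (n + 1)) K) (v : Fin p → Fin (n + 1) → K) :
    integral K n (poly n q * wedge K n p v) = 0 :=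
  integral_of_ne hp (mul_mem_grade (poly_mem q) (wedge_mem v) (zero_add p))

/-- Forms pulled back along a non-injective map have integral zero. -/
theorem integral_pullback_of_not_injective [CharZero K] {n m : ℕ} {g : Fin (n + 1) → Fin (m + 1)}
    (hg : ¬ Function.Injective g) : integral K n ∘ₗ (pullback (K := K) g).toLinearMap = 0 := by
  refine linearMap_ext_poly_mul_wedge fun p q v => ?_
  rw [LinearMap.comp_apply, AlgHom.toLinearMap_apply, map_mul, pullback_poly, pullback_wedge,
    LinearMap.zero_apply]
  by_cases hp : p = n
  · subst hp
    simp only [Function.Injective, not_forall] at hg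
    obtain ⟨i, j, hij, hne⟩ := hg
    -- Covectors pulled back along g take the same value at i and at j, and so does the row of ones:
    -- columns i and j coincide.
    rw [integral_poly_mul_wedge, Matrix.det_zero_of_column_eq hne, mul_zero]
    intro k
    refine Fin.cases ?_ (fun k => ?_) k
    · simp
    · simp [hij]
  · exact integral_poly_mul_wedge_of_ne hp _ _

/-- Integration by parts in the variable x_i. The point is that the right-hand side, the moment
formula with the shift n instead of n + 1, does not depend on i. It can therefore be factored out of
the sum over facets in Stokes' formula. -/
theorem moment_pderiv_add_moment_face [CharZero K] {n : ℕ} (i : Fin (n + 1 + 1))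
    (q : MvPolynomial (Fin (n + 1 + 1)) K) :
    moment K (n + 1) (MvPolynomial.pderiv i q) +
        moment K n (MvPolynomial.aeval
          (fun j => ∑ l with i.succAbove l = j, (MvPolynomial.X l : MvPolynomial _ K)) q) =
      (MvPolynomial.basisMonomials (Fin (n + 1 + 1)) K).constr K (fun k =>
        ((∏ i, (k i).factorial : ℕ) : K) / (((∑ i, k i) + n).factorial : K)) q := by
  suffices h : moment K (n + 1) ∘ₗ (MvPolynomial.pderiv i).toLinearMap +
      moment K n ∘ₗ (MvPolynomial.aeval
          (fun j => ∑ l with i.succAbove l = j, (MvPolynomial.X l : MvPolynomial _ K))).toLinearMap =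
      (MvPolynomial.basisMonomials (Fin (n + 1 + 1)) K).constr K (fun k =>
        ((∏ i, (k i).factorial : ℕ) : K) / (((∑ i, k i) + n).factorial : K)) from
    LinearMap.congr_fun h q
  refine (MvPolynomial.basisMonomials (Fin (n + 1 + 1)) K).ext fun k => ?_
  rw [Module.Basis.constr_basis]
  simp only [MvPolynomial.coe_basisMonomials, LinearMap.add_apply, LinearMap.comp_apply,
    AlgHom.toLinearMap_apply, Derivation.coeFn_coe,
    MvPolynomial.pderiv_monomial, MvPolynomial.aeval_monomial, map_one, one_mul]
  rw [Finsupp.prod_fintype _ _ (by simp), Fin.prod_univ_succAbove _ i]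
  have e0 : ∑ l with i.succAbove l = i, (MvPolynomial.X l : MvPolynomial (Fin (n + 1)) K) = 0 :=
    Finset.sum_eq_zero fun l hl => absurd (Finset.mem_filter.1 hl).2 (Fin.succAbove_ne i l)
  have e1 : ∀ j, ∑ l with i.succAbove l = i.succAbove j,
      (MvPolynomial.X l : MvPolynomial (Fin (n + 1)) K) = MvPolynomial.X j := by
    intro j
    simp [Finset.filter_eq']
  simp only [e0, e1]
  have e2 : MvPolynomial.monomial (k - Finsupp.single i 1) (k i : K) =
      (k i : K) • MvPolynomial.monomial (k - Finsupp.single i 1) 1 := by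
    rw [MvPolynomial.smul_monomial, smul_eq_mul, mul_one]
  rw [e2, map_smul, smul_eq_mul, moment_monomial]
  -- Exactly one of the two terms survives: the facet term if x_i does not occur in the monomial,
  -- the derivative otherwise. Either one is the right-hand side.
  by_cases hk : k i = 0
  · have e3 : ∏ j, (MvPolynomial.X j : MvPolynomial (Fin (n + 1)) K) ^ k (i.succAbove j) =
        MvPolynomial.monomial (Finsupp.equivFunOnFinite.symm fun j => k (i.succAbove j)) 1 := by
      rw [MvPolynomial.monomial_eq, Finsupp.prod_fintype _ _ (by simp)]
      simp
    rw [hk, pow_zero, one_mul, e3, moment_monomial,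
      Fin.prod_univ_succAbove (fun j => (k j).factorial) i, Fin.sum_univ_succAbove k i]
    simp [hk]
  · obtain ⟨c, hc⟩ := Nat.exists_eq_succ_of_ne_zero hk
    rw [zero_pow hk, zero_mul, map_zero, add_zero, Fin.prod_univ_succAbove _ i,
      Fin.sum_univ_succAbove _ i, Fin.prod_univ_succAbove _ i, Fin.sum_univ_succAbove _ i]
    simp only [Finsupp.tsub_apply, Finsupp.single_eq_same, hc,
      Finsupp.single_eq_of_ne (Fin.succAbove_ne i _), Nat.factorial_succ, tsub_zero,
      Nat.succ_eq_add_one, Nat.add_sub_cancel]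
    rw [show c + 1 + ∑ j, k (i.succAbove j) + n = c + ∑ j, k (i.succAbove j) + (n + 1) by ring]
    push_cast
    ring

/-- Expansion along row 1, which is a unit vector. The overall minus sign is (−1)^1 from the index
of that row; deleting column i restricts the covectors to the i-th facet. -/
theorem det_cons_cons_single {n : ℕ} (i : Fin (n + 1 + 1)) (v : Fin n → Fin (n + 1 + 1) → K) :
    Matrix.det (Matrix.of (Fin.cons 1 (Fin.cons (Pi.single i 1) v) :
        Fin (n + 1 + 1) → Fin (n + 1 + 1) → K)) =
      -((-1) ^ (i : ℕ) * Matrix.det (Matrix.of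
        (Fin.cons 1 fun j => v j ∘ i.succAbove : Fin (n + 1) → Fin (n + 1) → K))) := by
  rw [Matrix.det_succ_row _ 1, Finset.sum_eq_single i]
  · have : Matrix.submatrix (Matrix.of (Fin.cons 1 (Fin.cons (Pi.single i 1) v) :
        Fin (n + 1 + 1) → Fin (n + 1 + 1) → K)) (Fin.succAbove 1) i.succAbove = Matrix.of
        (Fin.cons 1 fun j => v j ∘ i.succAbove : Fin (n + 1) → Fin (n + 1) → K) := by
      ext a b
      refine Fin.cases ?_ (fun a => ?_) a
      · simp
      · rw [Matrix.submatrix_apply, ← Fin.succ_zero_eq_one, Fin.succ_succAbove_succ]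
        simp
    rw [this]
    have h1 : (Matrix.of (Fin.cons 1 (Fin.cons (Pi.single i 1) v) :
        Fin (n + 1 + 1) → Fin (n + 1 + 1) → K)) 1 i = 1 := by
      rw [← Fin.succ_zero_eq_one]; simp
    rw [h1, pow_add]
    simp
  · intro j _ hj
    have h1 : (Matrix.of (Fin.cons 1 (Fin.cons (Pi.single i 1) v) :
        Fin (n + 1 + 1) → Fin (n + 1 + 1) → K)) 1 j = 0 := by
      rw [← Fin.succ_zero_eq_one]; simp [hj]
    rw [h1]; simp
  · simp

/-- The unit vectors add up to a second row of ones; equivalently, (∑ dx_i)² = 0. -/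
theorem sum_det_cons_cons_single {n : ℕ} (v : Fin n → Fin (n + 1 + 1) → K) :
    ∑ i, Matrix.det (Matrix.of (Fin.cons 1 (Fin.cons (Pi.single i 1) v) :
        Fin (n + 1 + 1) → Fin (n + 1 + 1) → K)) = 0 := by
  have e : ∀ u : Fin (n + 1 + 1) → K, ExteriorAlgebra.ιMulti K (n + 1) (Fin.cons u v) =
      ExteriorAlgebra.ι K u * ExteriorAlgebra.ιMulti K n v := by
    intro u
    rw [ExteriorAlgebra.ιMulti_apply, ExteriorAlgebra.ιMulti_apply, List.ofFn_succ]; simp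
  simp only [← orient_ιMulti, e]
  rw [← map_sum, ← Finset.sum_mul, orient, LinearMap.comp_apply, LinearMap.mulLeft_apply,
    ← map_sum, ← mul_assoc, ExteriorAlgebra.ι_sq_zero, zero_mul, map_zero]

/-- The Stokes formula on the affine standard simplex. -/
theorem integral_d [CharZero K] (n : ℕ) :
    integral K (n + 1) ∘ₗ d K (n + 1) =
      ∑ i : Fin (n + 1 + 1), (-1 : K) ^ (i : ℕ) •
        (integral K n ∘ₗ (pullback (K := K) i.succAbove).toLinearMap) := by
  refine linearMap_ext_poly_mul_wedge fun p q v => ?_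
  simp only [LinearMap.comp_apply, LinearMap.sum_apply, LinearMap.smul_apply,
    AlgHom.toLinearMap_apply, map_mul, pullback_poly, pullback_wedge, d_poly_mul_wedge, map_sum]
  by_cases hp : p = n
  · subst hp
    simp only [integral_poly_mul_wedge, smul_eq_mul]
    -- The i-th term of the difference of the two sides is a number independent of i times the
    -- determinant with e_i as second row, and those determinants add up to zero.
    rw [← sub_eq_zero, ← Finset.sum_sub_distrib]
    refine Eq.trans (Finset.sum_congr rfl fun i _ => ?_)
      ((Finset.mul_sum _ _ _).symm.trans (mul_eq_zero_of_right
        ((MvPolynomial.basisMonomials (Fin (p + 1 + 1)) K).constr K (fun k =>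
          ((∏ i, (k i).factorial : ℕ) : K) / (((∑ i, k i) + p).factorial : K)) q)
        (sum_det_cons_cons_single v)))
    rw [← moment_pderiv_add_moment_face i q, add_mul, det_cons_cons_single]
    ring
  · rw [Finset.sum_eq_zero fun i _ => integral_poly_mul_wedge_of_ne (by omega) _ _,
      Finset.sum_eq_zero fun i _ => by rw [integral_poly_mul_wedge_of_ne hp, smul_zero]]

end Integration

/-! ### The tensor product of forms: Koszul signs, total differential, pull-backs of the factors. -/

section Hat

variable {K : Type*} [Field K]

/-- Left multiplication by `a ⊗ b` with `b` of degree `0`. -/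
theorem of_symm_tmul_mul_zero {n m : ℕ} (a : Omega K (n + 1)) {b : Omega K m}
    (hb : b ∈ grade K m 0) (u : HatOmega K n m) :
    (GradedTensorProduct.of K (grade K (n + 1)) (grade K m)).symm (a ᵍ⊗ₜ[K] b * u) =
      TensorProduct.map (LinearMap.mulLeft K a) (LinearMap.mulLeft K b)
        ((GradedTensorProduct.of K (grade K (n + 1)) (grade K m)).symm u) := by
  obtain ⟨z, rfl⟩ := (GradedTensorProduct.of K (grade K (n + 1)) (grade K m)).surjective u
  rw [LinearEquiv.symm_apply_apply]
  induction z using TensorProduct.induction_on with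
  | zero => simp
  | add y z hy hz => rw [map_add, mul_add, map_add, hy, hz, map_add]
  | tmul a' b' =>
    refine DirectSum.Decomposition.inductionOn (grade K (n + 1)) ?_ (fun {i} a' => ?_) ?_ a'
    · simp
    · have h := tmul_mul_tmul_of_mem a hb a'.2 b'
      rw [zero_mul, pow_zero, one_smul] at h
      exact congrArg (GradedTensorProduct.of K (grade K (n + 1)) (grade K m)).symm h
    · intro y z hy hz
      rw [TensorProduct.add_tmul, map_add, mul_add, map_add, hy, hz, map_add]

/-- Left multiplication by `a ⊗ b` with `b` of degree `1`. -/
theorem of_symm_tmul_mul_one {n m : ℕ} (a : Omega K (n + 1)) {b : Omega K m}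
    (hb : b ∈ grade K m 1) (u : HatOmega K n m) :
    (GradedTensorProduct.of K (grade K (n + 1)) (grade K m)).symm (a ᵍ⊗ₜ[K] b * u) =
      TensorProduct.map (LinearMap.mulLeft K a ∘ₗ (invol K (n + 1)).toLinearMap)
        (LinearMap.mulLeft K b)
        ((GradedTensorProduct.of K (grade K (n + 1)) (grade K m)).symm u) := by
  obtain ⟨z, rfl⟩ := (GradedTensorProduct.of K (grade K (n + 1)) (grade K m)).surjective u
  rw [LinearEquiv.symm_apply_apply]
  induction z using TensorProduct.induction_on with
  | zero => simp
  | add y z hy hz => rw [map_add, mul_add, map_add, hy, hz, map_add]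
  | tmul a' b' =>
    refine DirectSum.Decomposition.inductionOn (grade K (n + 1)) ?_ (fun {i} a' => ?_) ?_ a'
    · simp
    · have h := tmul_mul_tmul_of_mem a hb a'.2 b'
      rw [one_mul] at h
      refine (congrArg (GradedTensorProduct.of K (grade K (n + 1)) (grade K m)).symm h).trans ?_
      rw [TensorProduct.map_tmul, LinearMap.comp_apply, AlgHom.toLinearMap_apply,
        invol_of_mem a'.2, map_smul (LinearMap.mulLeft K a), ← TensorProduct.smul_tmul',
        LinearMap.mulLeft_apply,
        LinearMap.mulLeft_apply]
      -- The graded tensor product has its Koszul sign in `ℤˣ`, the involution has it in `K`;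
      -- splitting by parity identifies the two.
      rcases Nat.even_or_odd i with hi | hi
      · rw [hi.neg_one_pow, hi.neg_one_pow, one_smul, one_smul]; rfl
      · rw [hi.neg_one_pow, hi.neg_one_pow, Units.neg_smul, one_smul, map_neg]
        exact (neg_one_smul K ((a * (a' : Omega K (n + 1))) ⊗ₜ[K] (b * b'))).symm
    · intro y z hy hz
      rw [TensorProduct.add_tmul, map_add, mul_add, map_add, hy, hz, map_add]

variable (K) in
/-- The total differential of `Ω̂ₙ ⊗ Ωₘ`. -/
def totalD (n m : ℕ) : Omega K n ⊗[K] Omega K m →ₗ[K] Omega K n ⊗[K] Omega K m :=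
  TensorProduct.map (d K n) LinearMap.id + TensorProduct.map (invol K n).toLinearMap (d K m)

theorem totalD_map_x_x {n m : ℕ} (i : Fin (n + 1)) (j : Fin (m + 1))
    (z : Omega K n ⊗[K] Omega K m) :
    totalD K n m (TensorProduct.map (LinearMap.mulLeft K (x K i)) (LinearMap.mulLeft K (x K j)) z) =
      TensorProduct.map (LinearMap.mulLeft K (dx K i)) (LinearMap.mulLeft K (x K j)) z +
      TensorProduct.map (LinearMap.mulLeft K (x K i) ∘ₗ (invol K n).toLinearMap)
        (LinearMap.mulLeft K (dx K j)) z +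
      TensorProduct.map (LinearMap.mulLeft K (x K i)) (LinearMap.mulLeft K (x K j))
        (totalD K n m z) := by
  induction z using TensorProduct.induction_on with
  | zero => simp
  | add y z hy hz => simp only [map_add, hy, hz]; abel
  | tmul a b =>
    simp only [totalD, LinearMap.add_apply, TensorProduct.map_tmul, LinearMap.mulLeft_apply,
      LinearMap.comp_apply, AlgHom.toLinearMap_apply, LinearMap.id_apply, d_x_mul, map_mul,
      invol_x, TensorProduct.add_tmul, TensorProduct.tmul_add, map_add]
    abel

theorem totalD_map_x {n m : ℕ} (i : Fin (n + 1)) (z : Omega K n ⊗[K] Omega K m) :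
    totalD K n m (TensorProduct.map (LinearMap.mulLeft K (x K i)) LinearMap.id z) =
      TensorProduct.map (LinearMap.mulLeft K (dx K i)) LinearMap.id z +
      TensorProduct.map (LinearMap.mulLeft K (x K i)) LinearMap.id (totalD K n m z) := by
  induction z using TensorProduct.induction_on with
  | zero => simp
  | add y z hy hz => simp only [map_add, hy, hz]; abel
  | tmul a b =>
    simp only [totalD, LinearMap.add_apply, TensorProduct.map_tmul, LinearMap.mulLeft_apply,
      AlgHom.toLinearMap_apply, LinearMap.id_apply, d_x_mul, map_mul,
      invol_x, TensorProduct.add_tmul, map_add]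
    abel

theorem totalD_map_dx {n m : ℕ} (i : Fin (n + 1)) (z : Omega K n ⊗[K] Omega K m) :
    totalD K n m (TensorProduct.map (LinearMap.mulLeft K (dx K i)) LinearMap.id z) =
      -TensorProduct.map (LinearMap.mulLeft K (dx K i)) LinearMap.id (totalD K n m z) := by
  induction z using TensorProduct.induction_on with
  | zero => simp
  | add y z hy hz => simp only [map_add, hy, hz]; abel
  | tmul a b =>
    simp only [totalD, LinearMap.add_apply, TensorProduct.map_tmul, LinearMap.mulLeft_apply,
      AlgHom.toLinearMap_apply, LinearMap.id_apply, d_dx_mul, map_mul,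
      invol_dx, TensorProduct.neg_tmul, map_add, neg_mul]
    abel

/-- Neither summand anticommutes with the total differential alone: each produces a cross term dx_i
⊗ dx_j, with opposite signs. The sum is left multiplication by the total differential of x_i ⊗ x_j,
and is closed. -/
theorem totalD_map_dx_x_add {n m : ℕ} (i : Fin (n + 1)) (j : Fin (m + 1))
    (z : Omega K n ⊗[K] Omega K m) :
    totalD K n m (TensorProduct.map (LinearMap.mulLeft K (dx K i)) (LinearMap.mulLeft K (x K j)) z +
      TensorProduct.map (LinearMap.mulLeft K (x K i) ∘ₗ (invol K n).toLinearMap)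
        (LinearMap.mulLeft K (dx K j)) z) =
      -(TensorProduct.map (LinearMap.mulLeft K (dx K i)) (LinearMap.mulLeft K (x K j))
        (totalD K n m z) +
      TensorProduct.map (LinearMap.mulLeft K (x K i) ∘ₗ (invol K n).toLinearMap)
        (LinearMap.mulLeft K (dx K j)) (totalD K n m z)) := by
  induction z using TensorProduct.induction_on with
  | zero => simp
  | add y z hy hz =>
    simp only [map_add] at hy hz ⊢
    rw [add_add_add_comm, hy, hz]
    abel
  | tmul a b =>
    simp only [totalD, LinearMap.add_apply, TensorProduct.map_tmul, LinearMap.mulLeft_apply,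
      LinearMap.comp_apply, AlgHom.toLinearMap_apply, LinearMap.id_apply, d_x_mul, d_dx_mul,
      map_mul, invol_x, invol_dx, d_invol, invol_invol, TensorProduct.add_tmul,
      TensorProduct.tmul_add, TensorProduct.neg_tmul, TensorProduct.tmul_neg, neg_mul, mul_neg,
      map_add]
    abel

theorem rTensor_pullback_map_mulLeft {n n' m : ℕ} (g : Fin (n' + 1) → Fin (n + 1))
    (a : Omega K n) (φ : Omega K m →ₗ[K] Omega K m) (z : Omega K n ⊗[K] Omega K m) :
    (pullback g).toLinearMap.rTensor (Omega K m)
        (TensorProduct.map (LinearMap.mulLeft K a) φ z) =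
      TensorProduct.map (LinearMap.mulLeft K (pullback g a)) φ
        ((pullback g).toLinearMap.rTensor (Omega K m) z) := by
  induction z using TensorProduct.induction_on with
  | zero => simp
  | add y z hy hz => simp only [map_add, hy, hz]
  | tmul b c => simp

theorem rTensor_pullback_map_mulLeft_invol {n n' m : ℕ} (g : Fin (n' + 1) → Fin (n + 1))
    (a : Omega K n) (φ : Omega K m →ₗ[K] Omega K m) (z : Omega K n ⊗[K] Omega K m) :
    (pullback g).toLinearMap.rTensor (Omega K m)
        (TensorProduct.map (LinearMap.mulLeft K a ∘ₗ (invol K n).toLinearMap) φ z) =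
      TensorProduct.map (LinearMap.mulLeft K (pullback g a) ∘ₗ (invol K n').toLinearMap) φ
        ((pullback g).toLinearMap.rTensor (Omega K m) z) := by
  induction z using TensorProduct.induction_on with
  | zero => simp
  | add y z hy hz => simp only [map_add, hy, hz]
  | tmul b c => simp [pullback_invol]

/-- The vertex map `Fin.cons 0 (Fin.succ ∘ c)` fixes the vertex of s and acts by c on those of the
t_i. Hence s pulls back to s and t_i to the sum of the t_k over the fibre of c. -/
theorem sum_filter_cons_zero {n n' : ℕ} {V : Type*} [AddCommMonoid V]
    (c : Fin (n' + 1) → Fin (n + 1)) (u : Fin (n' + 1 + 1) → V) :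
    ∑ k with (Fin.cons 0 (Fin.succ ∘ c) : Fin (n' + 1 + 1) → Fin (n + 1 + 1)) k = 0, u k = u 0 := by
  rw [Finset.sum_filter, Fin.sum_univ_succ]
  simp

theorem sum_filter_cons_succ {n n' : ℕ} {V : Type*} [AddCommMonoid V]
    (c : Fin (n' + 1) → Fin (n + 1)) (u : Fin (n' + 1 + 1) → V) (i : Fin (n + 1)) :
    ∑ k with (Fin.cons 0 (Fin.succ ∘ c) : Fin (n' + 1 + 1) → Fin (n + 1 + 1)) k = i.succ, u k =
      ∑ k with c k = i, u k.succ := by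
  rw [Finset.sum_filter, Fin.sum_univ_succ, Finset.sum_filter]
  simp [Fin.succ_ne_zero, eq_comm]

theorem mulLeft_sum {n : ℕ} {ι : Type*} (s : Finset ι) (u : ι → Omega K n) :
    LinearMap.mulLeft K (∑ i ∈ s, u i) = ∑ i ∈ s, LinearMap.mulLeft K (u i) := by
  ext a; simp [Finset.sum_mul]

theorem map_sum_left_apply {n n' m m' : ℕ} {ι : Type*} (s : Finset ι)
    (u : ι → Omega K n →ₗ[K] Omega K n') (φ : Omega K m →ₗ[K] Omega K m')
    (z : Omega K n ⊗[K] Omega K m) :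
    TensorProduct.map (∑ i ∈ s, u i) φ z = ∑ i ∈ s, TensorProduct.map (u i) φ z := by
  induction z using TensorProduct.induction_on with
  | zero => simp
  | add y z hy hz => simp only [map_add, hy, hz, Finset.sum_add_distrib]
  | tmul b c => simp [TensorProduct.sum_tmul]

theorem map_sum_right_apply {n n' m m' : ℕ} {ι : Type*} (s : Finset ι)
    (φ : Omega K n →ₗ[K] Omega K n') (u : ι → Omega K m →ₗ[K] Omega K m')
    (z : Omega K n ⊗[K] Omega K m) :
    TensorProduct.map φ (∑ i ∈ s, u i) z = ∑ i ∈ s, TensorProduct.map φ (u i) z := by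
  induction z using TensorProduct.induction_on with
  | zero => simp
  | add y z hy hz => simp only [map_add, hy, hz, Finset.sum_add_distrib]
  | tmul b c => simp [TensorProduct.tmul_sum]

theorem x_zero_omega_zero : (x K 0 : Omega K 0) = 1 := by
  have h := poly_sum (K := K) (n := 0)
  rwa [map_sum, Fin.sum_univ_one] at h

theorem dx_zero_omega_zero : (dx K 0 : Omega K 0) = 0 := by
  have h := covec_sum (K := K) (n := 0)
  rwa [Fin.sum_univ_one] at h

theorem lTensor_pullback_map_mulLeft {n p m : ℕ} (g : Fin (p + 1) → Fin (m + 1))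
    (φ : Omega K n →ₗ[K] Omega K n) (a : Omega K m) (z : Omega K n ⊗[K] Omega K m) :
    (pullback g).toLinearMap.lTensor (Omega K n)
        (TensorProduct.map φ (LinearMap.mulLeft K a) z) =
      TensorProduct.map φ (LinearMap.mulLeft K (pullback g a))
        ((pullback g).toLinearMap.lTensor (Omega K n) z) := by
  induction z using TensorProduct.induction_on with
  | zero => simp
  | add y z hy hz => simp only [map_add, hy, hz]
  | tmul b c => simp

theorem lTensor_pullback_map_id {n p m : ℕ} (g : Fin (p + 1) → Fin (m + 1))
    (φ : Omega K n →ₗ[K] Omega K n) (z : Omega K n ⊗[K] Omega K m) :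
    (pullback g).toLinearMap.lTensor (Omega K n)
        (TensorProduct.map φ LinearMap.id z) =
      TensorProduct.map φ LinearMap.id ((pullback g).toLinearMap.lTensor (Omega K n) z) := by
  induction z using TensorProduct.induction_on with
  | zero => simp
  | add y z hy hz => simp only [map_add, hy, hz]
  | tmul b c => simp

/-! ### The pull-back along f̂: chain map, restriction to facets, naturality. -/

section Tensor

variable [CharZero K]

/-- The pull-back along `f̂` with values in the underlying tensor product. -/
def hatTensor {n m : ℕ} (f : Fin (n + 1) → Fin (m + 1)) :
    Omega K m →ₗ[K] Omega K (n + 1) ⊗[K] Omega K m :=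
  (GradedTensorProduct.of K (grade K (n + 1)) (grade K m)).symm.toLinearMap ∘ₗ
    (hatPull f).toLinearMap

theorem hatTensor_one {n m : ℕ} (f : Fin (n + 1) → Fin (m + 1)) :
    hatTensor f (1 : Omega K m) = 1 ⊗ₜ 1 := by
  rw [hatTensor, LinearMap.comp_apply, AlgHom.toLinearMap_apply, map_one]
  rfl

theorem hatTensor_x_mul {n m : ℕ} (f : Fin (n + 1) → Fin (m + 1)) (j : Fin (m + 1))
    (a : Omega K m) :
    hatTensor f (x K j * a) =
      TensorProduct.map (LinearMap.mulLeft K (x K 0)) (LinearMap.mulLeft K (x K j))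
        (hatTensor f a) +
      ∑ i with f i = j, TensorProduct.map (LinearMap.mulLeft K (x K i.succ)) LinearMap.id
        (hatTensor f a) := by
  rw [hatTensor, LinearMap.comp_apply, AlgHom.toLinearMap_apply, map_mul, hatPull_x, add_mul,
    ← tmul_sum_left, Finset.sum_mul, LinearEquiv.coe_coe, map_add, map_sum,
    of_symm_tmul_mul_zero _ (x_mem j)]
  simp only [of_symm_tmul_mul_zero _ (one_mem_grade m), LinearMap.mulLeft_one]
  rfl

theorem hatTensor_dx_mul {n m : ℕ} (f : Fin (n + 1) → Fin (m + 1)) (j : Fin (m + 1))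
    (a : Omega K m) :
    hatTensor f (dx K j * a) =
      TensorProduct.map (LinearMap.mulLeft K (dx K 0)) (LinearMap.mulLeft K (x K j))
        (hatTensor f a) +
      TensorProduct.map (LinearMap.mulLeft K (x K 0) ∘ₗ (invol K (n + 1)).toLinearMap)
        (LinearMap.mulLeft K (dx K j)) (hatTensor f a) +
      ∑ i with f i = j, TensorProduct.map (LinearMap.mulLeft K (dx K i.succ)) LinearMap.id
        (hatTensor f a) := by
  rw [hatTensor, LinearMap.comp_apply, AlgHom.toLinearMap_apply, map_mul, hatPull_dx, hatDX,
    add_mul, add_mul, ← tmul_sum_left, Finset.sum_mul, LinearEquiv.coe_coe, map_add, map_add,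
    map_sum, of_symm_tmul_mul_zero _ (x_mem j), of_symm_tmul_mul_one _ (dx_mem j)]
  simp only [of_symm_tmul_mul_zero _ (one_mem_grade m), LinearMap.mulLeft_one]
  rfl

/-- Pull-back commutes with d. It suffices to test multiplication by generators, where the pull-back
of dx_j is the total differential of the pull-back of x_j. -/
theorem totalD_hatTensor {n m : ℕ} (f : Fin (n + 1) → Fin (m + 1)) (a : Omega K m) :
    totalD K (n + 1) m (hatTensor f a) = hatTensor f (d K m a) := by
  suffices h : totalD K (n + 1) m ∘ₗ hatTensor f = hatTensor f ∘ₗ d K m from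
    LinearMap.congr_fun h a
  refine linearMap_ext ?_ ?_ ?_
  · simp [hatTensor_one, totalD, d_one]
  · intro j a h
    simp only [LinearMap.comp_apply] at h ⊢
    rw [d_x_mul, map_add, hatTensor_x_mul, hatTensor_x_mul, hatTensor_dx_mul, map_add, map_sum,
      totalD_map_x_x, ← h]
    simp only [totalD_map_x, Finset.sum_add_distrib]
    abel
  · intro j a h
    simp only [LinearMap.comp_apply] at h ⊢
    rw [d_dx_mul, map_neg, hatTensor_dx_mul, hatTensor_dx_mul, map_add, map_sum,
      totalD_map_dx_x_add, ← h]
    simp only [totalD_map_dx, Finset.sum_neg_distrib]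
    abel

/-- Reparametrisation of the vertices spanned by the parameters `t`. -/
theorem rTensor_pullback_cons_hatTensor {n n' m : ℕ} (f : Fin (n + 1) → Fin (m + 1))
    (c : Fin (n' + 1) → Fin (n + 1)) :
    (pullback (K := K) (Fin.cons 0 (Fin.succ ∘ c) :
        Fin (n' + 1 + 1) → Fin (n + 1 + 1))).toLinearMap.rTensor (Omega K m) ∘ₗ hatTensor f =
      hatTensor (f ∘ c) := by
  refine linearMap_ext ?_ ?_ ?_
  · simp [hatTensor_one]
  · intro j a h
    simp only [LinearMap.comp_apply] at h ⊢
    rw [hatTensor_x_mul, hatTensor_x_mul, map_add, map_sum, rTensor_pullback_map_mulLeft, h,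
      pullback_x, sum_filter_cons_zero, sum_filter_comp f c]
    congr 1
    refine Finset.sum_congr rfl fun i _ => ?_
    rw [rTensor_pullback_map_mulLeft, h, pullback_x, sum_filter_cons_succ, mulLeft_sum,
      map_sum_left_apply]
  · intro j a h
    simp only [LinearMap.comp_apply] at h ⊢
    rw [hatTensor_dx_mul, hatTensor_dx_mul, map_add, map_add, map_sum,
      rTensor_pullback_map_mulLeft, rTensor_pullback_map_mulLeft_invol, h,
      pullback_x, pullback_dx, sum_filter_cons_zero, sum_filter_cons_zero, sum_filter_comp f c]
    congr 1
    refine Finset.sum_congr rfl fun i _ => ?_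
    rw [rTensor_pullback_map_mulLeft, h, pullback_dx, sum_filter_cons_succ, mulLeft_sum,
      map_sum_left_apply]

/-- Restriction to the face `s = 0`. -/
theorem rTensor_pullback_succ_hatTensor {n m : ℕ} (f : Fin (n + 1) → Fin (m + 1)) :
    (pullback (K := K) (Fin.succ : Fin (n + 1) → Fin (n + 1 + 1))).toLinearMap.rTensor
      (Omega K m) ∘ₗ hatTensor f =
      (TensorProduct.mk K (Omega K n) (Omega K m)).flip 1 ∘ₗ (pullback f).toLinearMap := by
  -- On this facet s pulls back to 0 and t_i to the i-th coordinate, so every term involving the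
  -- second factor disappears.
  have e0 : ∀ u : Fin (n + 1) → Omega K n, ∑ k with Fin.succ k = 0, u k = 0 := fun u =>
    Finset.sum_eq_zero fun k hk => absurd (Finset.mem_filter.1 hk).2 (Fin.succ_ne_zero k)
  have e1 : ∀ (i : Fin (n + 1)) (u : Fin (n + 1) → Omega K n),
      ∑ k with Fin.succ k = i.succ, u k = u i := fun i u => by
    simp [Finset.filter_eq']
  refine linearMap_ext ?_ ?_ ?_
  · simp [hatTensor_one]
  · intro j a h
    simp only [LinearMap.comp_apply] at h ⊢
    rw [hatTensor_x_mul, map_add, map_sum]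
    simp only [rTensor_pullback_map_mulLeft, h, pullback_x, e0, e1]
    simp [pullback_x, Finset.sum_mul]
  · intro j a h
    simp only [LinearMap.comp_apply] at h ⊢
    rw [hatTensor_dx_mul, map_add, map_add, map_sum]
    simp only [rTensor_pullback_map_mulLeft, rTensor_pullback_map_mulLeft_invol, h, pullback_dx,
      pullback_x, e0, e1]
    simp [pullback_dx, Finset.sum_mul]

/-- Restriction to the vertex `s = 1`. -/
theorem rTensor_pullback_zero_hatTensor {m : ℕ} (f : Fin (0 + 1) → Fin (m + 1)) :
    (pullback (K := K) (fun _ => 0 : Fin (0 + 1) → Fin (0 + 1 + 1))).toLinearMap.rTensor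
      (Omega K m) ∘ₗ hatTensor f = TensorProduct.mk K (Omega K 0) (Omega K m) 1 := by
  refine linearMap_ext ?_ ?_ ?_
  · simp [hatTensor_one]
  · intro j a h
    simp only [LinearMap.comp_apply] at h ⊢
    rw [hatTensor_x_mul, map_add, map_sum]
    simp only [rTensor_pullback_map_mulLeft, h, pullback_x]
    -- At this vertex s is 1 and every t_i is 0, which leaves x_j on the second factor.
    simp [(Fin.succ_ne_zero _).symm, x_zero_omega_zero]
  · intro j a h
    simp only [LinearMap.comp_apply] at h ⊢
    rw [hatTensor_dx_mul, map_add, map_add, map_sum]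
    simp only [rTensor_pullback_map_mulLeft, rTensor_pullback_map_mulLeft_invol, h, pullback_dx,
      pullback_x]
    simp [(Fin.succ_ne_zero _).symm, x_zero_omega_zero, dx_zero_omega_zero]

/-- The affine map g sends the join of v with the face h to the join of g(v) with the face g∘h.
Pulling back along the two sides of this square gives the identity. -/
theorem hatTensor_pullback {n p m : ℕ} (h : Fin (n + 1) → Fin (p + 1))
    (g : Fin (p + 1) → Fin (m + 1)) :
    hatTensor h ∘ₗ (pullback (K := K) g).toLinearMap =
      (pullback g).toLinearMap.lTensor (Omega K (n + 1)) ∘ₗ hatTensor (g ∘ h) := by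
  refine linearMap_ext ?_ ?_ ?_
  · simp [hatTensor_one]
  · intro j a e
    simp only [LinearMap.comp_apply, AlgHom.toLinearMap_apply] at e ⊢
    rw [hatTensor_x_mul, map_add, map_sum, lTensor_pullback_map_mulLeft, map_mul, pullback_x,
      Finset.sum_mul, map_sum, mulLeft_sum, map_sum_right_apply]
    simp only [hatTensor_x_mul, lTensor_pullback_map_id, ← e, sum_filter_comp g h,
      Finset.sum_add_distrib]
  · intro j a e
    simp only [LinearMap.comp_apply, AlgHom.toLinearMap_apply] at e ⊢
    rw [hatTensor_dx_mul, map_add, map_add, map_sum, lTensor_pullback_map_mulLeft,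
      lTensor_pullback_map_mulLeft, map_mul, pullback_dx, pullback_x,
      Finset.sum_mul, map_sum, mulLeft_sum, mulLeft_sum, map_sum_right_apply, map_sum_right_apply]
    simp only [hatTensor_dx_mul, lTensor_pullback_map_id, ← e, sum_filter_comp g h,
      Finset.sum_add_distrib]

end Tensor

end Hat

/-! ### Fibre integration, and Stokes' formula for the operators k_f. -/

section Face

variable {K : Type*} [Field K] [CharZero K]

/-- Integration over the first factor of `Ωₙ ⊗ Ωₘ`. -/
def fiberIntegral (K : Type*) [Field K] [CharZero K] (n m : ℕ) :
    Omega K n ⊗[K] Omega K m →ₗ[K] Omega K m :=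
  (TensorProduct.lid K (Omega K m)).toLinearMap ∘ₗ (integral K n).rTensor (Omega K m)

theorem fiberIntegral_tmul {n m : ℕ} (a : Omega K n) (b : Omega K m) :
    fiberIntegral K n m (a ⊗ₜ b) = integral K n a • b := by
  simp [fiberIntegral]

theorem manettiFace_eq {n m : ℕ} (f : Fin (n + 1) → Fin (m + 1)) :
    manettiFace K f = fiberIntegral K (n + 1) m ∘ₗ hatTensor f := rfl

/-- The Stokes formula for the integral over the first factor. -/
theorem fiberIntegral_totalD {n m : ℕ} (z : Omega K (n + 1) ⊗[K] Omega K m) :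
    fiberIntegral K (n + 1) m (totalD K (n + 1) m z) =
      ∑ i : Fin (n + 1 + 1), (-1 : K) ^ (i : ℕ) • fiberIntegral K n m
        ((pullback (K := K) i.succAbove).toLinearMap.rTensor (Omega K m) z) +
      (-1 : K) ^ (n + 1) • d K m (fiberIntegral K (n + 1) m z) := by
  induction z using TensorProduct.induction_on with
  | zero => simp
  | add y z hy hz =>
    simp only [map_add, hy, hz, smul_add, Finset.sum_add_distrib]
    abel
  | tmul a b =>
    have h := LinearMap.congr_fun (integral_d (K := K) n) a
    simp only [LinearMap.comp_apply, LinearMap.sum_apply, LinearMap.smul_apply,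
      AlgHom.toLinearMap_apply, smul_eq_mul] at h
    simp only [totalD, LinearMap.add_apply, TensorProduct.map_tmul, map_add, fiberIntegral_tmul,
      LinearMap.id_apply, AlgHom.toLinearMap_apply, integral_invol, LinearMap.rTensor_tmul, h,
      map_smul, Finset.sum_smul, smul_smul]

theorem fiberIntegral_rTensor_of_not_injective {n n' m : ℕ} {g : Fin (n + 1) → Fin (n' + 1)}
    (hg : ¬ Function.Injective g) (z : Omega K n' ⊗[K] Omega K m) :
    fiberIntegral K n m ((pullback (K := K) g).toLinearMap.rTensor (Omega K m) z) = 0 := by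
  induction z using TensorProduct.induction_on with
  | zero => simp
  | add y z hy hz => rw [map_add, map_add, hy, hz, add_zero]
  | tmul a b =>
    have h := LinearMap.congr_fun (integral_pullback_of_not_injective (K := K) hg) a
    rw [LinearMap.comp_apply, LinearMap.zero_apply] at h
    rw [LinearMap.rTensor_tmul, fiberIntegral_tmul, h, zero_smul]

/-- If f(i) = f(j), then f factors through the map of [n] collapsing j onto i. So f̂ factors through
a degenerate map of Δ̂ⁿ, along which every integral vanishes. -/
theorem manettiFace_of_not_injective {n m : ℕ} {f : Fin (n + 1) → Fin (m + 1)}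
    (hf : ¬ Function.Injective f) : manettiFace K f = 0 := by
  simp only [Function.Injective, not_forall] at hf
  obtain ⟨i, j, hij, hne⟩ := hf
  have hc : f ∘ Function.update id j i = f := by
    ext k
    by_cases hk : k = j
    · subst hk; simp [hij]
    · simp [Function.update_of_ne hk]
  have hinj : ¬ Function.Injective (Fin.cons 0 (Fin.succ ∘ Function.update id j i) :
      Fin (n + 1 + 1) → Fin (n + 1 + 1)) := by
    intro h
    -- Both vertices are sent to `i.succ`; the successors skip the vertex of s.
    have := @h i.succ j.succ (by simp [Function.update_of_ne hne])
    exact hne (Fin.succ_injective _ this)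
  ext a
  have h := LinearMap.congr_fun (rTensor_pullback_cons_hatTensor (K := K) f
    (Function.update id j i)) a
  rw [hc, LinearMap.comp_apply] at h
  rw [manettiFace_eq, LinearMap.comp_apply, ← h, fiberIntegral_rTensor_of_not_injective hinj,
    LinearMap.zero_apply]

theorem manettiFace_pullback {n p m : ℕ} (h : Fin (n + 1) → Fin (p + 1))
    (g : Fin (p + 1) → Fin (m + 1)) (a : Omega K m) :
    manettiFace K h (pullback g a) = pullback g (manettiFace K (g ∘ h) a) := by
  have e := LinearMap.congr_fun (hatTensor_pullback (K := K) h g) a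
  rw [LinearMap.comp_apply, LinearMap.comp_apply, AlgHom.toLinearMap_apply] at e
  rw [manettiFace_eq, manettiFace_eq, LinearMap.comp_apply, LinearMap.comp_apply, e]
  generalize hatTensor (g ∘ h) a = z
  induction z using TensorProduct.induction_on with
  | zero => simp
  | add y z hy hz => simp only [map_add, hy, hz]
  | tmul a b => simp [fiberIntegral_tmul]

/-- The facet s = 0 contributes a constant: there f̂ is the face inclusion and does not depend on v.
As s is coordinate 0, this facet enters Stokes' formula with sign +1. -/
theorem fiberIntegral_face_zero {n m : ℕ} (f : Fin (n + 1) → Fin (m + 1)) (a : Omega K m) :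
    fiberIntegral K n m ((pullback (K := K) (Fin.succAbove (0 : Fin (n + 1 + 1)))
      ).toLinearMap.rTensor (Omega K m) (hatTensor f a)) = integral K n (pullback f a) • 1 := by
  have h := LinearMap.congr_fun (rTensor_pullback_succ_hatTensor (K := K) f) a
  simp only [LinearMap.comp_apply, LinearMap.flip_apply, TensorProduct.mk_apply,
    AlgHom.toLinearMap_apply] at h
  rw [Fin.succAbove_zero, h, fiberIntegral_tmul]

/-- Setting t_i = 0 leaves the join with the i-th facet of f. Because s comes first, t_i is
coordinate i + 1, and the sign in Stokes' formula is −(−1)^i. -/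
theorem fiberIntegral_face_succ {n m : ℕ} (f : Fin (n + 1 + 1) → Fin (m + 1))
    (i : Fin (n + 1 + 1)) (a : Omega K m) :
    fiberIntegral K (n + 1) m ((pullback (K := K) i.succ.succAbove
      ).toLinearMap.rTensor (Omega K m) (hatTensor f a)) = manettiFace K (f ∘ i.succAbove) a := by
  have e : (i.succ.succAbove : Fin (n + 1 + 1) → Fin (n + 1 + 1 + 1)) =
      Fin.cons 0 (Fin.succ ∘ i.succAbove) := by
    ext k
    refine Fin.cases ?_ (fun k => ?_) k
    · simp
    · simp
  have h := LinearMap.congr_fun (rTensor_pullback_cons_hatTensor (K := K) f i.succAbove) a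
  rw [LinearMap.comp_apply] at h
  rw [e, h, manettiFace_eq, LinearMap.comp_apply]

theorem integral_zero_one : integral K 0 1 = 1 := by
  have h := integral_monomial (K := K) (n := 0) (fun _ => 0) 0
  simpa using h

/-- For a vertex f the facet t_0 = 0 is the point s = 1, at which f̂ is the identity in v. This is
the source of the identity map in the homotopy formula. -/
theorem fiberIntegral_face_vertex {m : ℕ} (f : Fin (0 + 1) → Fin (m + 1)) (a : Omega K m) :
    fiberIntegral K 0 m ((pullback (K := K) (Fin.succAbove (1 : Fin (0 + 1 + 1)))
      ).toLinearMap.rTensor (Omega K m) (hatTensor f a)) = a := by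
  have e : (Fin.succAbove (1 : Fin (0 + 1 + 1)) : Fin (0 + 1) → Fin (0 + 1 + 1)) = fun _ => 0 := by
    decide
  have h := LinearMap.congr_fun (rTensor_pullback_zero_hatTensor (K := K) f) a
  rw [LinearMap.comp_apply, TensorProduct.mk_apply] at h
  rw [e, h, fiberIntegral_tmul, integral_zero_one, one_smul]

theorem manettiFace_d_zero {m : ℕ} (f : Fin (0 + 1) → Fin (m + 1)) (a : Omega K m) :
    manettiFace K f (d K m a) =
      integral K 0 (pullback f a) • 1 - a - d K m (manettiFace K f a) := by
  rw [manettiFace_eq, LinearMap.comp_apply, ← totalD_hatTensor, fiberIntegral_totalD,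
    Fin.sum_univ_two, fiberIntegral_face_zero, fiberIntegral_face_vertex]
  simp [sub_eq_add_neg]

/-- Here Δ̂ has dimension n + 2, so the d-term of Stokes' formula has sign (−1)^(n+2). Moved across
the equation, it is the opposite of the Leibniz sign of a Whitney form of degree n + 1. -/
theorem manettiFace_d_succ {n m : ℕ} (f : Fin (n + 1 + 1) → Fin (m + 1)) (a : Omega K m) :
    manettiFace K f (d K m a) = integral K (n + 1) (pullback f a) • 1 -
      ∑ i : Fin (n + 1 + 1), (-1 : K) ^ (i : ℕ) • manettiFace K (f ∘ i.succAbove) a -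
      (-1 : K) ^ (n + 1) • d K m (manettiFace K f a) := by
  rw [manettiFace_eq, LinearMap.comp_apply, ← totalD_hatTensor, fiberIntegral_totalD,
    Fin.sum_univ_succ, fiberIntegral_face_zero]
  simp only [fiberIntegral_face_succ, Fin.val_succ, pow_succ, Fin.val_zero, pow_zero, one_smul,
    mul_neg_one, neg_smul, Finset.sum_neg_distrib, sub_eq_add_neg, LinearMap.comp_apply]

end Face

/-! ### Degrees: fibre integration over Δ̂ⁿ lowers the degree by n + 1. -/

section Degree

variable {K : Type*} [Field K]

/-- The part of total degree `p` of `Ωₙ ⊗ Ωₘ`. -/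
def totalGrade (K : Type*) [Field K] (n m p : ℕ) : Submodule K (Omega K n ⊗[K] Omega K m) :=
  Submodule.span K {z | ∃ r s, ∃ a ∈ grade K n r, ∃ b ∈ grade K m s, r + s = p ∧ z = a ⊗ₜ b}

theorem map_mem_totalGrade {n m i j p k : ℕ} {φ : Omega K n →ₗ[K] Omega K n}
    {ψ : Omega K m →ₗ[K] Omega K m} (hφ : ∀ q, ∀ a ∈ grade K n q, φ a ∈ grade K n (i + q))
    (hψ : ∀ q, ∀ b ∈ grade K m q, ψ b ∈ grade K m (j + q)) (hk : i + j + p = k)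
    {z : Omega K n ⊗[K] Omega K m} (hz : z ∈ totalGrade K n m p) :
    TensorProduct.map φ ψ z ∈ totalGrade K n m k := by
  induction hz using Submodule.span_induction with
  | zero => simp
  | add a b _ _ h1 h2 => rw [map_add]; exact add_mem h1 h2
  | smul c a _ h => rw [map_smul]; exact Submodule.smul_mem _ _ h
  | mem z h =>
    obtain ⟨r, s, a, ha, b, hb, h, rfl⟩ := h
    exact Submodule.subset_span ⟨_, _, φ a, hφ _ _ ha, ψ b, hψ _ _ hb, by omega, rfl⟩

theorem mulLeft_mem_grade {n i : ℕ} {a : Omega K n} (ha : a ∈ grade K n i) (q : ℕ) :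
    ∀ b ∈ grade K n q, LinearMap.mulLeft K a b ∈ grade K n (i + q) :=
  fun _ hb => mul_mem_grade ha hb rfl

theorem id_mem_grade {n : ℕ} (q : ℕ) :
    ∀ b ∈ grade K n q, (LinearMap.id : Omega K n →ₗ[K] Omega K n) b ∈ grade K n (0 + q) :=
  fun _ hb => (zero_add q).symm ▸ hb

variable [CharZero K]

theorem hatTensor_mem_totalGrade {n m p : ℕ} (f : Fin (n + 1) → Fin (m + 1)) {a : Omega K m}
    (ha : a ∈ grade K m p) : hatTensor f a ∈ totalGrade K (n + 1) m p := by
  refine grade_induction (P := fun p a => hatTensor f a ∈ totalGrade K (n + 1) m p)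
    ?_ ?_ ?_ ?_ ?_ ?_ ha
  · rw [hatTensor_one]
    exact Submodule.subset_span ⟨0, 0, 1, one_mem_grade _, 1, one_mem_grade _, rfl, rfl⟩
  · simp
  · intro p a b h1 h2; rw [map_add]; exact add_mem h1 h2
  · intro p c a h; rw [map_smul]; exact Submodule.smul_mem _ _ h
  · intro p i a h
    rw [hatTensor_x_mul]
    exact add_mem (map_mem_totalGrade (mulLeft_mem_grade (x_mem _))
        (mulLeft_mem_grade (x_mem _)) (by omega) h)
      (sum_mem fun i _ => map_mem_totalGrade (mulLeft_mem_grade (x_mem _)) id_mem_grade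
        (by omega) h)
  · intro p i a h
    rw [hatTensor_dx_mul]
    refine add_mem (add_mem (map_mem_totalGrade (mulLeft_mem_grade (dx_mem _))
        (mulLeft_mem_grade (x_mem _)) (by omega) h)
        (map_mem_totalGrade (i := 0) (fun q b hb => ?_)
          (mulLeft_mem_grade (dx_mem _)) (by omega) h))
      (sum_mem fun i _ => map_mem_totalGrade (mulLeft_mem_grade (dx_mem _)) id_mem_grade
        (by omega) h)
    rw [LinearMap.comp_apply, AlgHom.toLinearMap_apply, invol_of_mem hb, map_smul]
    exact Submodule.smul_mem _ _ (mul_mem_grade (x_mem _) hb rfl)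

/-- Only components with first factor of degree n have a nonzero integral, and in these the second
factor carries the remaining degree p. -/
theorem fiberIntegral_mem_grade {n m p : ℕ} {z : Omega K n ⊗[K] Omega K m}
    (hz : z ∈ totalGrade K n m (n + p)) : fiberIntegral K n m z ∈ grade K m p := by
  induction hz using Submodule.span_induction with
  | zero => simp
  | add a b _ _ h1 h2 => rw [map_add]; exact add_mem h1 h2
  | smul c a _ h => rw [map_smul]; exact Submodule.smul_mem _ _ h
  | mem z h =>
    obtain ⟨r, s, a, ha, b, hb, h, rfl⟩ := h
    rw [fiberIntegral_tmul]
    by_cases hr : r = n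
    · obtain rfl : s = p := by omega
      exact Submodule.smul_mem _ _ hb
    · rw [integral_of_ne hr ha, zero_smul]
      exact zero_mem _

theorem fiberIntegral_eq_zero {n m p : ℕ} (hp : p < n) {z : Omega K n ⊗[K] Omega K m}
    (hz : z ∈ totalGrade K n m p) : fiberIntegral K n m z = 0 := by
  induction hz using Submodule.span_induction with
  | zero => simp
  | add a b _ _ h1 h2 => rw [map_add, h1, h2, add_zero]
  | smul c a _ h => rw [map_smul, h, smul_zero]
  | mem z h =>
    obtain ⟨r, s, a, ha, b, hb, h, rfl⟩ := h
    rw [fiberIntegral_tmul, integral_of_ne (by omega) ha, zero_smul]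

theorem manettiFace_mem_grade {n m p : ℕ} (f : Fin (n + 1) → Fin (m + 1)) {a : Omega K m}
    (ha : a ∈ grade K m (n + 1 + p)) : manettiFace K f a ∈ grade K m p :=
  fiberIntegral_mem_grade (hatTensor_mem_totalGrade f ha)

theorem manettiFace_eq_zero {n m p : ℕ} (hp : p < n + 1) (f : Fin (n + 1) → Fin (m + 1))
    {a : Omega K m} (ha : a ∈ grade K m p) : manettiFace K f a = 0 :=
  fiberIntegral_eq_zero hp (hatTensor_mem_totalGrade f ha)

end Degree

/-! ### Whitney forms: alternation, differential, pull-back and duality with faces. -/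

section Whitney

variable {K : Type*} [Field K]

variable (K) in
/-- A covector as a linear function. -/
def coord (m : ℕ) : (Fin (m + 1) → K) →ₗ[K] Omega K m := Fintype.linearCombination K (x K)

theorem coord_apply {m : ℕ} (u : Fin (m + 1) → K) : coord K m u = ∑ i, u i • x K i := rfl

theorem coord_single {m : ℕ} (i : Fin (m + 1)) : coord K m (Pi.single i 1) = x K i := by
  rw [coord, Fintype.linearCombination_apply_single, one_smul]

theorem coord_mul_comm {m : ℕ} (u : Fin (m + 1) → K) (a : Omega K m) :
    coord K m u * a = a * coord K m u := by
  simp only [coord_apply, Finset.sum_mul, Finset.mul_sum, smul_mul_assoc, mul_smul_comm, x_mul_comm]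

theorem coord_mem {m : ℕ} (u : Fin (m + 1) → K) : coord K m u ∈ grade K m 0 := by
  rw [coord_apply]
  exact sum_mem fun i _ => Submodule.smul_mem _ _ (x_mem i)

theorem d_coord_mul {m : ℕ} (u : Fin (m + 1) → K) (a : Omega K m) :
    d K m (coord K m u * a) = covec m u * a + coord K m u * d K m a := by
  simp only [coord_apply, covec_eq_sum, Finset.sum_mul, map_sum, smul_mul_assoc, map_smul, d_x_mul,
    smul_add, Finset.sum_add_distrib]

theorem d_wedge {m p : ℕ} (v : Fin p → Fin (m + 1) → K) : d K m (wedge K m p v) = 0 := by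
  have h := d_poly_mul_wedge (1 : MvPolynomial (Fin (m + 1)) K) v
  simpa using h

theorem pullback_coord {n m : ℕ} (g : Fin (n + 1) → Fin (m + 1)) (u : Fin (m + 1) → K) :
    pullback g (coord K m u) = coord K n (u ∘ g) := by
  simp only [coord_apply, map_sum, map_smul, pullback_x, Finset.smul_sum, Function.comp_apply]
  rw [← Finset.sum_fiberwise (s := Finset.univ) (g := g)]
  refine Finset.sum_congr rfl fun j _ => Finset.sum_congr rfl fun i hi => ?_
  rw [(Finset.mem_filter.1 hi).2]

variable (K) in
/-- The Whitney form of `n + 1` linear functions, without the factor `n!`. -/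
def whitneyAlt (m n : ℕ) : (Fin (m + 1) → K) [⋀^Fin (n + 1)]→ₗ[K] Omega K m :=
  AlternatingMap.alternatizeUncurryFin
    { toFun := fun u => (LinearMap.mulLeft K (coord K m u)).compAlternatingMap (wedge K m n)
      map_add' := fun u u' => by ext v; simp [add_mul]
      map_smul' := fun c u => by ext v; simp }

theorem whitneyAlt_apply {m n : ℕ} (v : Fin (n + 1) → Fin (m + 1) → K) :
    whitneyAlt K m n v =
      ∑ i : Fin (n + 1), (-1 : K) ^ (i : ℕ) •
        (coord K m (v i) * wedge K m n fun j => v (i.succAbove j)) := by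
  rw [whitneyAlt, AlternatingMap.alternatizeUncurryFin_apply]
  refine Finset.sum_congr rfl fun i _ => ?_
  rcases Nat.even_or_odd (i : ℕ) with hi | hi
  · rw [hi.neg_one_pow, hi.neg_one_pow, one_smul, one_smul]; rfl
  · rw [hi.neg_one_pow, hi.neg_one_pow, neg_one_smul, neg_one_smul]; rfl

theorem whitney_eq {n m : ℕ} (f : Fin (n + 1) → Fin (m + 1)) :
    whitney K f = (n.factorial : K) • whitneyAlt K m n fun i => Pi.single (f i) 1 := by
  simp only [whitney, whitneyAlt_apply, coord_single, wedge_apply, covec_single]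

theorem whitneyAlt_mem {n m : ℕ} (v : Fin (n + 1) → Fin (m + 1) → K) :
    whitneyAlt K m n v ∈ grade K m n := by
  rw [whitneyAlt_apply]
  exact sum_mem fun i _ => Submodule.smul_mem _ _
    (mul_mem_grade (coord_mem _) (wedge_mem _) (zero_add n))

theorem whitney_mem_grade {n m : ℕ} (f : Fin (n + 1) → Fin (m + 1)) :
    whitney K f ∈ grade K m n := by
  rw [whitney_eq]
  exact Submodule.smul_mem _ _ (whitneyAlt_mem _)

theorem whitney_of_not_injective {n m : ℕ} {f : Fin (n + 1) → Fin (m + 1)}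
    (hf : ¬ Function.Injective f) : whitney K f = 0 := by
  simp only [Function.Injective, not_forall] at hf
  obtain ⟨i, j, hij, hne⟩ := hf
  rw [whitney_eq, AlternatingMap.map_eq_zero_of_eq _ _ (by rw [hij]) hne, smul_zero]

/-- Moving the i-th argument to the front passes it over i others, each at the cost of a sign. -/
theorem neg_one_pow_smul_map_cons_succAbove {n : ℕ} {M N : Type*} [AddCommGroup M] [Module K M]
    [AddCommGroup N] [Module K N] (A : M [⋀^Fin (n + 1)]→ₗ[K] N) (v : Fin (n + 1) → M)
    (i : Fin (n + 1)) :
    (-1 : K) ^ (i : ℕ) • A (Fin.cons (v i) fun j => v (i.succAbove j)) = A v := by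
  have h := AlternatingMap.map_insertNth A i (v i) (i.removeNth v)
  rw [Fin.insertNth_self_removeNth] at h
  rw [h]
  rcases Nat.even_or_odd (i : ℕ) with hi | hi
  · rw [hi.neg_one_pow, hi.neg_one_pow, one_smul, one_smul]; rfl
  · rw [hi.neg_one_pow, hi.neg_one_pow, neg_one_smul, neg_one_smul]; rfl

/-- Differentiating the linear coefficient of the i-th term puts its covector in front of the
others. The sign (−1)^i then restores the order, so the n + 1 terms are equal. -/
theorem d_whitneyAlt {m n : ℕ} (v : Fin (n + 1) → Fin (m + 1) → K) :
    d K m (whitneyAlt K m n v) = ((n + 1 : ℕ) : K) • wedge K m (n + 1) v := by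
  rw [whitneyAlt_apply, map_sum]
  have h : ∀ i : Fin (n + 1), d K m ((-1 : K) ^ (i : ℕ) •
      (coord K m (v i) * wedge K m n fun j => v (i.succAbove j))) = wedge K m (n + 1) v := by
    intro i
    rw [map_smul, d_coord_mul, d_wedge, mul_zero, add_zero, ← wedge_cons,
      neg_one_pow_smul_map_cons_succAbove]
  rw [Finset.sum_congr rfl fun i _ => h i, Finset.sum_const, Finset.card_univ, Fintype.card_fin,
    Nat.cast_smul_eq_nsmul]

theorem whitneyAlt_cons {m n : ℕ} (u : Fin (m + 1) → K) (v : Fin (n + 1) → Fin (m + 1) → K) :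
    whitneyAlt K m (n + 1) (Fin.cons u v) =
      coord K m u * wedge K m (n + 1) v - covec m u * whitneyAlt K m n v := by
  rw [whitneyAlt_apply, Fin.sum_univ_succ, whitneyAlt_apply, Finset.mul_sum, sub_eq_add_neg,
    ← Finset.sum_neg_distrib]
  congr 1
  · simp
  · refine Finset.sum_congr rfl fun i _ => ?_
    have e : (fun j => (Fin.cons u v : Fin (n + 1 + 1) → Fin (m + 1) → K) (i.succ.succAbove j)) =
        Fin.cons u fun j => v (i.succAbove j) := by
      ext1 j
      refine Fin.cases ?_ (fun j => ?_) j
      · simp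
      · simp
    rw [e, Fin.cons_succ, wedge_cons, mul_smul_comm, Fin.val_succ, pow_succ, mul_neg_one, neg_smul,
      coord_mul_comm, coord_mul_comm, mul_assoc]

theorem single_cons {n m : ℕ} (k : Fin (m + 1)) (f : Fin n → Fin (m + 1)) :
    (fun i => (Pi.single ((Fin.cons k f : Fin (n + 1) → Fin (m + 1)) i) 1 : Fin (m + 1) → K)) =
      Fin.cons (Pi.single k 1) fun i => Pi.single (f i) 1 := by
  ext1 i
  refine Fin.cases ?_ (fun j => ?_) i
  · rfl
  · rfl

/-- Summed over k, the expansion of ω_{(k,f)} collapses by ∑ x_k = 1 and ∑ dx_k = 0 to (n+1)! times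
the wedge of the covectors of f. The normalisation n! in ω_f is what makes this equal to dω_f. -/
theorem d_whitney {n m : ℕ} (f : Fin (n + 1) → Fin (m + 1)) :
    d K m (whitney K f) = ∑ k, whitney K (Fin.cons k f : Fin (n + 1 + 1) → Fin (m + 1)) := by
  have h1 : ∑ j, x K j = (1 : Omega K m) := (map_sum (poly m) _ _).symm.trans poly_sum
  simp only [whitney_eq, single_cons, whitneyAlt_cons, coord_single, map_smul, d_whitneyAlt]
  rw [← Finset.smul_sum, Finset.sum_sub_distrib, ← Finset.sum_mul, ← Finset.sum_mul, h1, covec_sum,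
    one_mul, zero_mul, sub_zero, smul_smul, Nat.factorial_succ, Nat.cast_mul, mul_comm]

/-- Moving a vertex of a Whitney form to the front. -/
theorem whitney_cons_succAbove {n m : ℕ} (g : Fin (n + 1 + 1) → Fin (m + 1))
    (i : Fin (n + 1 + 1)) :
    whitney K (Fin.cons (g i) (g ∘ i.succAbove) : Fin (n + 1 + 1) → Fin (m + 1)) =
      (-1 : K) ^ (i : ℕ) • whitney K g := by
  have h := neg_one_pow_smul_map_cons_succAbove (whitneyAlt K m (n + 1))
    (fun j => Pi.single (g j) 1) i
  have hsq : (-1 : K) ^ (i : ℕ) * (-1) ^ (i : ℕ) = 1 := by rw [← mul_pow]; simp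
  rw [whitney_eq, whitney_eq, single_cons, smul_comm, ← h, smul_smul _ _ (whitneyAlt K m _ _), hsq,
    one_smul]
  rfl

/-- The cochain differential of Whitney forms. -/
theorem sum_d_whitney_mul {n m : ℕ} (Φ : (Fin (n + 1) → Fin (m + 1)) → Omega K m) :
    ∑ f : Fin (n + 1) ↪o Fin (m + 1), d K m (whitney K f) * Φ f =
      ∑ g : Fin (n + 1 + 1) ↪o Fin (m + 1), ∑ i : Fin (n + 1 + 1),
        (-1 : K) ^ (i : ℕ) • (whitney K g * Φ (g ∘ i.succAbove)) := by
  simp only [d_whitney, Finset.sum_mul]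
  rw [← Fintype.sum_prod_type', ← Fintype.sum_prod_type']
  symm
  -- An increasing map is determined by its range. This equality lets g be recovered from the facet
  -- g∘δ_i together with the vertex g(i).
  have hrange : ∀ (g : Fin (n + 1 + 1) ↪o Fin (m + 1)) (i : Fin (n + 1 + 1)),
      Set.range g = insert (g i) (Set.range (i.succAboveOrderEmb.trans g)) := by
    intro g i
    ext k
    simp only [Set.mem_range, Set.mem_insert_iff]
    constructor
    · rintro ⟨j, rfl⟩
      rcases Fin.eq_self_or_eq_succAbove i j with rfl | ⟨l, rfl⟩
      · exact Or.inl rfl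
      · exact Or.inr ⟨l, rfl⟩
    · rintro (rfl | ⟨l, rfl⟩)
      · exact ⟨i, rfl⟩
      · exact ⟨i.succAbove l, rfl⟩
  -- The pair (g, i) is matched with the facet g∘δ_i and the omitted vertex g(i).
  refine Finset.sum_of_injOn
    (fun z : (Fin (n + 1 + 1) ↪o Fin (m + 1)) × Fin (n + 1 + 1) =>
      (z.2.succAboveOrderEmb.trans z.1, z.1 z.2)) ?_ (fun _ _ => by simp) ?_ ?_
  · rintro ⟨g, i⟩ - ⟨g', i'⟩ - h
    simp only [Prod.mk.injEq] at h
    have hg : g = g' := by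
      have h1 := hrange g i
      rw [h.1, h.2, ← hrange g' i'] at h1
      exact OrderEmbedding.range_inj.1 h1
    subst hg
    exact Prod.ext rfl (g.injective h.2)
  -- A pair (f, k) that is not hit has k in the range of f, and its Whitney form has a repeated
  -- vertex. Otherwise, sorting the n + 2 vertices k, f(0), …, f(n) would give a preimage.
  · rintro ⟨f, k⟩ - hk
    suffices ¬ Function.Injective (Fin.cons k f : Fin (n + 1 + 1) → Fin (m + 1)) by
      rw [whitney_of_not_injective this, zero_mul]
    intro hinj
    refine hk ?_
    let s : Finset (Fin (m + 1)) := Finset.univ.image (Fin.cons k f : Fin (n + 1 + 1) → Fin (m + 1))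
    have hs : s.card = n + 1 + 1 := by
      rw [Finset.card_image_of_injective _ hinj, Finset.card_univ, Fintype.card_fin]
    have hsr : (s : Set (Fin (m + 1))) = insert k (Set.range f) := by
      rw [Finset.coe_image, Finset.coe_univ, Set.image_univ, Fin.range_cons]
    have hg := Finset.range_orderEmbOfFin s hs
    rw [hsr] at hg
    obtain ⟨i, hi⟩ : k ∈ Set.range (s.orderEmbOfFin hs) := by rw [hg]; exact Set.mem_insert _ _
    refine ⟨(s.orderEmbOfFin hs, i), by simp, Prod.ext ?_ hi⟩
    refine OrderEmbedding.range_inj.1 ?_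
    have h1 := hrange (s.orderEmbOfFin hs) i
    rw [hg, hi] at h1
    have hkf : k ∉ Set.range f := by
      rintro ⟨l, hl⟩
      exact absurd (@hinj 0 l.succ (by simp [hl])) (Fin.succ_ne_zero l).symm
    have hkg : k ∉ Set.range (i.succAboveOrderEmb.trans (s.orderEmbOfFin hs)) := by
      rintro ⟨l, hl⟩
      rw [← hi] at hl
      exact Fin.succAbove_ne i l ((s.orderEmbOfFin hs).injective hl)
    rw [← Set.insert_sdiff_self_of_notMem hkg, ← h1, Set.insert_sdiff_self_of_notMem hkf]
  · rintro ⟨g, i⟩ -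
    change (-1 : K) ^ (i : ℕ) • (whitney K g * Φ (g ∘ i.succAbove)) =
      whitney K (Fin.cons (g i) (g ∘ i.succAbove) : Fin (n + 1 + 1) → Fin (m + 1)) *
        Φ (g ∘ i.succAbove)
    rw [whitney_cons_succAbove, smul_mul_assoc]

theorem pullback_whitneyAlt {n p m : ℕ} (g : Fin (p + 1) → Fin (m + 1))
    (v : Fin (n + 1) → Fin (m + 1) → K) :
    pullback g (whitneyAlt K m n v) = whitneyAlt K p n fun i => v i ∘ g := by
  simp only [whitneyAlt_apply, map_sum, map_smul, map_mul, pullback_coord, pullback_wedge]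

/-- The covector of vertex j pulls back to the sum of the covectors of the vertices in its fibre.
Multilinear expansion then chooses a vertex in each fibre, which amounts to a lift h of f through g.
-/
theorem pullback_whitney {n p m : ℕ} (g : Fin (p + 1) → Fin (m + 1))
    (f : Fin (n + 1) → Fin (m + 1)) :
    pullback g (whitney K f) = ∑ h : Fin (n + 1) → Fin (p + 1) with g ∘ h = f, whitney K h := by
  simp only [whitney_eq, map_smul, pullback_whitneyAlt]
  rw [← Finset.smul_sum]
  congr 1
  have e : ∀ j : Fin (m + 1), (Pi.single j 1 : Fin (m + 1) → K) ∘ g =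
      ∑ i with g i = j, Pi.single i 1 := by
    intro j
    ext i
    simp [Finset.sum_apply, Pi.single_apply]
  simp only [e]
  rw [← AlternatingMap.coe_multilinearMap, MultilinearMap.map_sum_finset]
  refine Finset.sum_congr ?_ fun _ _ => rfl
  ext h
  simp [Fintype.mem_piFinset, funext_iff]

theorem moment_X {n : ℕ} (i : Fin (n + 1)) :
    moment K n (MvPolynomial.X i) = 1 / ((n + 1).factorial : K) := by
  rw [MvPolynomial.X, moment_monomial, Finset.prod_eq_one, Nat.cast_one]
  · simp [Finsupp.single_apply, add_comm]
  · intro j _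
    by_cases h : i = j
    · subst h; simp
    · simp [h]

variable [CharZero K]

/-- Each of the n + 1 summands integrates to 1/(n+1)!, since the orientation sign cancels the sign
in the form; the factor n! makes the total 1. -/
theorem integral_whitney_id (n : ℕ) :
    integral K n (whitney K (id : Fin (n + 1) → Fin (n + 1))) = 1 := by
  have h1 : ∀ i : Fin (n + 1), integral K n ((-1 : K) ^ (i : ℕ) •
      (coord K n (Pi.single (id i) 1) * wedge K n n fun j => Pi.single (id (i.succAbove j)) 1)) =
      1 / ((n + 1).factorial : K) := by
    intro i
    have h2 := det_cons_single (K := K) i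
    rw [show ∑ i, Pi.single i (1 : K) = (1 : Fin (n + 1) → K) from Finset.univ_sum_single 1] at h2
    simp only [id]
    rw [coord_single, ← poly_X, map_smul, integral_poly_mul_wedge, moment_X, h2, smul_eq_mul,
      mul_left_comm, ← mul_pow]
    simp
  rw [whitney_eq, map_smul, whitneyAlt_apply, map_sum, Finset.sum_congr rfl fun i _ => h1 i]
  rw [Finset.sum_const, Finset.card_univ, Fintype.card_fin, nsmul_eq_mul, smul_eq_mul,
    Nat.factorial_succ]
  have h3 : (n.factorial : K) ≠ 0 := Nat.cast_ne_zero.2 (Nat.factorial_ne_zero n)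
  have h4 : ((n + 1 : ℕ) : K) ≠ 0 := Nat.cast_ne_zero.2 (Nat.succ_ne_zero n)
  push_cast at *
  field_simp

theorem integral_pullback_whitney {n m : ℕ} (f g : Fin (n + 1) ↪o Fin (m + 1)) :
    integral K n (pullback g (whitney K f)) = if g = f then 1 else 0 := by
  rw [pullback_whitney]
  -- A lift h of a strictly increasing map through a strictly increasing map is strictly increasing.
  -- A strictly increasing self-map of a finite chain is the identity.
  have h : ∀ h : Fin (n + 1) → Fin (n + 1), g ∘ h = f → h = id ∧ g = f := by
    intro h e
    have hm : StrictMono h := fun a b hab => by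
      have := f.strictMono hab
      rw [← e] at this
      exact g.lt_iff_lt.1 this
    have hid : h = id := by
      refine congrArg DFunLike.coe (OrderEmbedding.range_inj.1 ?_ :
        OrderEmbedding.ofStrictMono h hm = OrderEmbedding.ofStrictMono id strictMono_id)
      exact (Finite.injective_iff_surjective.1 hm.injective).range_eq.trans Set.range_id.symm
    exact ⟨hid, DFunLike.coe_injective (by rw [← e, hid]; rfl)⟩
  split_ifs with hgf
  · subst hgf
    rw [Finset.sum_eq_single id]
    · exact integral_whitney_id n
    · intro k hk hne
      exact absurd (h k (Finset.mem_filter.1 hk).2).1 hne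
    · intro hne
      simp at hne
  · rw [Finset.sum_eq_zero, map_zero]
    intro k hk
    exact absurd (h k (Finset.mem_filter.1 hk).2).2 hgf

end Whitney

/-! ### Telescoping, naturality and the projector. -/

section Contraction

variable {K : Type*} [Field K]

theorem whitney_vertex {m : ℕ} (f : Fin (0 + 1) → Fin (m + 1)) : whitney K f = x K (f 0) := by
  simp [whitney]

/-- The vertex forms are the coordinates, a partition of unity on the simplex. -/
theorem sum_whitney_vertex (m : ℕ) :
    ∑ f : Fin (0 + 1) ↪o Fin (m + 1), whitney K f = (1 : Omega K m) := by
  have h1 : ∑ j, x K j = (1 : Omega K m) := (map_sum (poly m) _ _).symm.trans poly_sum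
  rw [← h1]
  simp only [whitney_vertex]
  refine Function.Bijective.sum_comp (e := fun f : Fin (0 + 1) ↪o Fin (m + 1) => f 0)
    ⟨fun f g h => ?_, fun k => ?_⟩ (fun j => x K j)
  · ext i
    rw [Fin.fin_one_eq_zero i]
    exact congrArg Fin.val h
  · exact ⟨OrderEmbedding.ofStrictMono (fun _ => k)
      fun i j hij => absurd ((Fin.fin_one_eq_zero i).trans (Fin.fin_one_eq_zero j).symm) hij.ne, rfl⟩

theorem isEmpty_orderEmb {n m : ℕ} (h : m < n) : IsEmpty (Fin (n + 1) ↪o Fin (m + 1)) :=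
  ⟨fun f => by
    have := Fintype.card_le_of_injective f f.injective
    simp only [Fintype.card_fin] at this
    omega⟩

/-- Dimensions above m contribute empty sums. The bound N allows sums over the faces of two
different simplices to run over the same dimensions. -/
theorem sum_range_orderEmb {m N : ℕ} (hN : m + 1 ≤ N) {V : Type*} [AddCommMonoid V]
    (u : ∀ n, (Fin (n + 1) ↪o Fin (m + 1)) → V) :
    ∑ n ∈ Finset.range (m + 1), ∑ f, u n f = ∑ n ∈ Finset.range N, ∑ f, u n f := by
  refine Finset.sum_subset (fun i hi => ?_) fun i _ hi => ?_
  · exact Finset.mem_range.2 ((Finset.mem_range.1 hi).trans_le hN)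
  · have := isEmpty_orderEmb (n := i) (m := m) (by simpa using hi)
    exact Fintype.sum_empty _

/-- Pulling back a sum over the faces of the target simplex. -/
theorem sum_pullback_whitney_mul {n p m : ℕ} (g : Fin (p + 1) →o Fin (m + 1))
    (Φ : (Fin (n + 1) → Fin (m + 1)) → Omega K p)
    (hΦ : ∀ f, ¬ Function.Injective f → Φ f = 0) :
    ∑ f : Fin (n + 1) ↪o Fin (m + 1), pullback g (whitney K f) * Φ f =
      ∑ h : Fin (n + 1) ↪o Fin (p + 1), whitney K h * Φ (g ∘ h) := by
  simp only [pullback_whitney, Finset.sum_mul]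
  rw [Finset.sum_sigma']
  symm
  classical
  -- Faces h collapsed by g drop out, since the coefficient vanishes on non-injective maps. The
  -- other h correspond to pairs (f, h) with f = g∘h.
  rw [← Finset.sum_filter_of_ne (p := fun h : Fin (n + 1) ↪o Fin (p + 1) =>
    Function.Injective (g ∘ h)) fun h _ hne' => by
      by_contra hinj
      exact hne' (by rw [hΦ _ hinj, mul_zero])]
  refine Finset.sum_bij (fun h hh => ⟨OrderEmbedding.ofStrictMono (g ∘ h)
    ((g.monotone.comp h.monotone).strictMono_of_injective (Finset.mem_filter.1 hh).2), h⟩)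
    ?_ ?_ ?_ ?_
  · intro h hh
    exact Finset.mem_sigma.2 ⟨Finset.mem_univ _, Finset.mem_filter.2 ⟨Finset.mem_univ _, rfl⟩⟩
  · intro h hh h' hh' e
    simp only [Sigma.mk.injEq, heq_eq_eq] at e
    exact DFunLike.coe_injective e.2
  · rintro ⟨f, h⟩ hfh
    simp only [Finset.mem_sigma, Finset.mem_univ, Finset.mem_filter, true_and] at hfh
    -- A monotone map reflects strict inequalities, so every lift of an increasing f is increasing.
    have hm : StrictMono h := fun a b hab => by
      have := f.strictMono hab
      rw [← hfh] at this
      exact g.monotone.reflect_lt this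
    refine ⟨OrderEmbedding.ofStrictMono h hm, ?_, ?_⟩
    · refine Finset.mem_filter.2 ⟨Finset.mem_univ _, ?_⟩
      change Function.Injective (g ∘ h)
      rw [hfh]
      exact f.injective
    · refine Sigma.ext (DFunLike.coe_injective hfh) ?_
      rfl
  · intro h hh
    rfl

theorem whitney_mem_whitneySpace {n m : ℕ} (f : Fin (n + 1) ↪o Fin (m + 1)) :
    whitney K f ∈ whitneySpace K m :=
  Submodule.subset_span ⟨n, f, rfl⟩

/-- The Whitney space is spanned by the forms of the faces. -/
theorem whitneySpace_induction {m : ℕ} {P : Omega K m → Prop} (zero : P 0)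
    (add : ∀ a b, P a → P b → P (a + b)) (smul : ∀ (c : K) a, P a → P (c • a))
    (whitney : ∀ n (f : Fin (n + 1) ↪o Fin (m + 1)), P (whitney K f))
    {a : Omega K m} (ha : a ∈ whitneySpace K m) : P a := by
  induction ha using Submodule.span_induction with
  | zero => exact zero
  | add a b _ _ h1 h2 => exact add a b h1 h2
  | smul c a _ h => exact smul c a h
  | mem a h =>
    obtain ⟨n, f, rfl⟩ := h
    by_cases hf : Function.Injective f
    · exact whitney n (OrderEmbedding.ofStrictMono f (f.monotone.strictMono_of_injective hf))
    · rw [whitney_of_not_injective hf]; exact zero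

theorem pullback_mem_whitneySpace {p m : ℕ} (g : Fin (p + 1) →o Fin (m + 1)) {a : Omega K m}
    (ha : a ∈ whitneySpace K m) : pullback g a ∈ whitneySpace K p := by
  refine whitneySpace_induction (P := fun a => pullback g a ∈ whitneySpace K p) ?_ ?_ ?_ ?_ ha
  · rw [map_zero]; exact zero_mem _
  · intro a b h1 h2; rw [map_add]; exact add_mem h1 h2
  · intro c a h; rw [map_smul]; exact Submodule.smul_mem _ _ h
  · intro n f
    rw [pullback_whitney]
    refine sum_mem fun h hh => ?_
    have hm : Monotone h := by
      intro a b hab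
      rcases hab.eq_or_lt with rfl | hab
      · exact le_rfl
      have := f.strictMono hab
      rw [← (Finset.mem_filter.1 hh).2] at this
      exact (g.monotone.reflect_lt this).le
    exact Submodule.subset_span ⟨n, ⟨h, hm⟩, rfl⟩

theorem isInternal_grade (m : ℕ) : DirectSum.IsInternal (grade K m) :=
  DirectSum.Decomposition.isInternal _

/-- Independence of the degrees is inherited from Ω. They exhaust the subspace because it is spanned
by homogeneous elements. -/
theorem isInternal_whitneySpace (m : ℕ) : DirectSum.IsInternal
    fun p => (grade K m p).comap (whitneySpace K m).subtype := by
  rw [DirectSum.isInternal_submodule_iff_iSupIndep_and_iSup_eq_top]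
  constructor
  · have h := (isInternal_grade (K := K) m).submodule_iSupIndep
    rw [iSupIndep_def] at h ⊢
    intro p
    rw [Submodule.disjoint_def]
    intro a ha hb
    refine Subtype.ext (Submodule.disjoint_def.1 (h p) a ha ?_)
    have := Submodule.mem_map_of_mem (f := (whitneySpace K m).subtype) hb
    simp only [Submodule.map_iSup] at this
    exact (iSup₂_mono fun q _ => Submodule.map_comap_le _ _) this
  · refine Submodule.map_injective_of_injective (whitneySpace K m).injective_subtype
      (le_antisymm (Submodule.map_mono le_top) ?_)
    rw [Submodule.map_top, Submodule.range_subtype]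
    intro a ha
    refine whitneySpace_induction (zero_mem _) (fun _ _ => add_mem)
      (fun c _ h => Submodule.smul_mem _ c h) (fun n f => ?_) ha
    exact ⟨⟨whitney K f, whitney_mem_whitneySpace f⟩,
      Submodule.mem_iSup_of_mem n (whitney_mem_grade (K := K) f), rfl⟩

variable [CharZero K]

theorem manetti_apply {m : ℕ} (a : Omega K m) :
    manetti K m a = ∑ n ∈ Finset.range (m + 1), ∑ f : Fin (n + 1) ↪o Fin (m + 1),
      whitney K f * manettiFace K f a := by
  simp [manetti, LinearMap.sum_apply]

theorem whitneyProj_apply {m : ℕ} (a : Omega K m) :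
    whitneyProj K m a = ∑ n ∈ Finset.range (m + 1), ∑ f : Fin (n + 1) ↪o Fin (m + 1),
      integral K n (pullback f a) • whitney K f := by
  simp [whitneyProj, LinearMap.sum_apply]

theorem sum_homotopy_zero {m : ℕ} (a : Omega K m) :
    ∑ f : Fin (0 + 1) ↪o Fin (m + 1), (whitney K f * manettiFace K f (d K m a) +
        d K m (whitney K f * manettiFace K f a)) =
      ∑ f : Fin (0 + 1) ↪o Fin (m + 1), integral K 0 (pullback f a) • whitney K f - a +
      ∑ f : Fin (0 + 1) ↪o Fin (m + 1), d K m (whitney K f) * manettiFace K f a := by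
  have ha : a = ∑ f : Fin (0 + 1) ↪o Fin (m + 1), whitney K f * a := by
    rw [← Finset.sum_mul, sum_whitney_vertex, one_mul]
  rw [sub_eq_add_neg]
  -- The fourth occurrence is the isolated −a: it is distributed over the vertices by the partition
  -- of unity, to match the sum over f.
  nth_rw 4 [ha]
  rw [← sub_eq_add_neg, ← Finset.sum_sub_distrib, ← Finset.sum_add_distrib]
  refine Finset.sum_congr rfl fun f _ => ?_
  rw [manettiFace_d_zero, d_mul (whitney_mem_grade _), pow_zero, one_smul, mul_sub, mul_sub,
    mul_smul_comm, mul_one]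
  abel

/-- The facet terms of Stokes' formula in dimension n + 1 are rewritten, by the cochain
differential, as the terms dω_f ∧ k_f left over in dimension n. This is the telescoping step. -/
theorem sum_homotopy_succ {n m : ℕ} (a : Omega K m) :
    ∑ f : Fin (n + 1 + 1) ↪o Fin (m + 1), (whitney K f * manettiFace K f (d K m a) +
        d K m (whitney K f * manettiFace K f a)) =
      ∑ f : Fin (n + 1 + 1) ↪o Fin (m + 1), integral K (n + 1) (pullback f a) • whitney K f -
      ∑ f : Fin (n + 1) ↪o Fin (m + 1), d K m (whitney K f) * manettiFace K f a +
      ∑ f : Fin (n + 1 + 1) ↪o Fin (m + 1), d K m (whitney K f) * manettiFace K f a := by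
  rw [sum_d_whitney_mul fun f => manettiFace K f a, ← Finset.sum_sub_distrib,
    ← Finset.sum_add_distrib]
  refine Finset.sum_congr rfl fun f _ => ?_
  rw [manettiFace_d_succ, d_mul (whitney_mem_grade _), mul_sub, mul_sub,
    mul_smul_comm, mul_one, Finset.mul_sum, mul_smul_comm]
  simp only [mul_smul_comm]
  abel

theorem sum_homotopy {m : ℕ} (a : Omega K m) (N : ℕ) :
    ∑ n ∈ Finset.range (N + 1), ∑ f : Fin (n + 1) ↪o Fin (m + 1),
        (whitney K f * manettiFace K f (d K m a) + d K m (whitney K f * manettiFace K f a)) =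
      ∑ n ∈ Finset.range (N + 1), ∑ f : Fin (n + 1) ↪o Fin (m + 1),
        integral K n (pullback f a) • whitney K f - a +
      ∑ f : Fin (N + 1) ↪o Fin (m + 1), d K m (whitney K f) * manettiFace K f a := by
  induction N with
  | zero => rw [Finset.sum_range_one, Finset.sum_range_one, sum_homotopy_zero]
  | succ N ih =>
    rw [Finset.sum_range_succ, ih, sum_homotopy_succ, Finset.sum_range_succ _ (N + 1)]
    abel

/-- The homotopy formula `k d + d k = π - Id`. -/
theorem manetti_d_add_d_manetti (m : ℕ) :
    manetti K m ∘ₗ d K m + d K m ∘ₗ manetti K m = whitneyProj K m - LinearMap.id := by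
  ext a
  have h := sum_homotopy a m
  -- The term left over at the top is a sum over strictly increasing maps [m+1] → [m], of which
  -- there are none.
  have hT : ∑ f : Fin (m + 1) ↪o Fin (m + 1), d K m (whitney K f) * manettiFace K f a = 0 := by
    have := isEmpty_orderEmb (n := m + 1) (m := m) (Nat.lt_succ_self m)
    rw [sum_d_whitney_mul fun f => manettiFace K f a]
    exact Fintype.sum_empty _
  rw [hT, add_zero] at h
  simp only [Finset.sum_add_distrib] at h
  simp only [LinearMap.add_apply, LinearMap.comp_apply, LinearMap.sub_apply, LinearMap.id_apply]
  rw [manetti_apply, manetti_apply, whitneyProj_apply, ← h, map_sum]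
  simp only [map_sum]

theorem manetti_pullback {p m : ℕ} (g : Fin (p + 1) →o Fin (m + 1)) :
    manetti K p ∘ₗ (pullback (K := K) g).toLinearMap =
      (pullback (K := K) g).toLinearMap ∘ₗ manetti K m := by
  ext a
  simp only [LinearMap.comp_apply, AlgHom.toLinearMap_apply]
  -- Any common bound above both p and m would do.
  rw [manetti_apply, manetti_apply, sum_range_orderEmb (N := p + m + 1) (by omega),
    sum_range_orderEmb (N := p + m + 1) (by omega), map_sum]
  refine Finset.sum_congr rfl fun n _ => ?_
  have h := sum_pullback_whitney_mul g (fun f : Fin (n + 1) → Fin (m + 1) =>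
    pullback (K := K) g (manettiFace K f a)) fun f hf => by
      rw [manettiFace_of_not_injective hf, LinearMap.zero_apply, map_zero]
  simp only [map_sum, map_mul, manettiFace_pullback]
  exact h.symm

theorem whitneyProj_mem {m : ℕ} (a : Omega K m) : whitneyProj K m a ∈ whitneySpace K m := by
  rw [whitneyProj_apply]
  exact sum_mem fun n _ => sum_mem fun f _ => Submodule.smul_mem _ _ (whitney_mem_whitneySpace f)

theorem whitneyProj_whitney {n m : ℕ} (f : Fin (n + 1) ↪o Fin (m + 1)) :
    whitneyProj K m (whitney K f) = whitney K f := by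
  have hn : n ≤ m := by
    by_contra h
    exact (isEmpty_orderEmb (not_le.1 h)).elim f
  rw [whitneyProj_apply, Finset.sum_eq_single n]
  · simp only [integral_pullback_whitney]
    simp
  · intro k _ hk
    refine Finset.sum_eq_zero fun g _ => ?_
    rw [integral_of_ne hk.symm (pullback_mem_grade _ (whitney_mem_grade _)), zero_smul]
  · intro h
    exact absurd (Finset.mem_range.2 (by omega)) h

theorem whitneyProj_of_mem {m : ℕ} {a : Omega K m} (ha : a ∈ whitneySpace K m) :
    whitneyProj K m a = a :=
  whitneySpace_induction (P := fun a => whitneyProj K m a = a) (map_zero _)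
    (fun a b h1 h2 => by rw [map_add, h1, h2]) (fun c a h => by rw [map_smul, h])
    (fun _ f => whitneyProj_whitney f) ha

theorem isProj_whitneyProj (m : ℕ) : LinearMap.IsProj (whitneySpace K m) (whitneyProj K m) :=
  ⟨whitneyProj_mem, fun _ ha => whitneyProj_of_mem ha⟩

/-- Since d² = 0, composing the homotopy formula with d on either side leaves the same operator d k
d, so πd − d = dπ − d. -/
theorem whitneyProj_comp_d (m : ℕ) : whitneyProj K m ∘ₗ d K m = d K m ∘ₗ whitneyProj K m := by
  ext a
  have h := manetti_d_add_d_manetti (K := K) m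
  have h1 := LinearMap.congr_fun h (d K m a)
  have h2 := congrArg (d K m) (LinearMap.congr_fun h a)
  have hdd : ∀ b, d K m (d K m b) = 0 := LinearMap.congr_fun (d_comp_d m)
  simp only [LinearMap.add_apply, LinearMap.comp_apply, LinearMap.sub_apply, LinearMap.id_apply,
    hdd, map_zero, zero_add, map_add, map_sub, add_zero] at h1 h2 ⊢
  exact sub_left_injective (h1.symm.trans h2)

theorem d_mem_whitneySpace {m : ℕ} {a : Omega K m} (ha : a ∈ whitneySpace K m) :
    d K m a ∈ whitneySpace K m := by
  have h := LinearMap.congr_fun (whitneyProj_comp_d (K := K) m) a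
  rw [LinearMap.comp_apply, LinearMap.comp_apply, whitneyProj_of_mem ha] at h
  rw [← h]
  exact whitneyProj_mem _

theorem whitneyProj_mem_grade {m p : ℕ} {a : Omega K m} (ha : a ∈ grade K m p) :
    whitneyProj K m a ∈ grade K m p := by
  rw [whitneyProj_apply]
  refine sum_mem fun n _ => sum_mem fun f _ => ?_
  by_cases h : p = n
  · subst h
    exact Submodule.smul_mem _ _ (whitney_mem_grade _)
  · rw [integral_of_ne h (pullback_mem_grade _ ha), zero_smul]
    exact zero_mem _

/-- The face operator of dimension n lowers the degree by n + 1 and the Whitney form raises it by n.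
If n exceeds p, the form has too small a degree to be integrated and the term vanishes. -/
theorem manetti_mem_grade {m p : ℕ} {a : Omega K m} (ha : a ∈ grade K m (p + 1)) :
    manetti K m a ∈ grade K m p := by
  rw [manetti_apply]
  refine sum_mem fun n _ => sum_mem fun f _ => ?_
  by_cases h : p < n
  · rw [manettiFace_eq_zero (by omega) f ha, mul_zero]
    exact zero_mem _
  · obtain ⟨k, rfl⟩ := Nat.exists_eq_add_of_le (not_lt.1 h)
    refine mul_mem_grade (whitney_mem_grade _) (manettiFace_mem_grade (p := k) f ?_) rfl
    rwa [show n + 1 + k = n + k + 1 by omega]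

theorem manetti_eq_zero {m : ℕ} {a : Omega K m} (ha : a ∈ grade K m 0) : manetti K m a = 0 := by
  rw [manetti_apply]
  refine Finset.sum_eq_zero fun n _ => Finset.sum_eq_zero fun f _ => ?_
  rw [manettiFace_eq_zero (Nat.succ_pos n) f ha, mul_zero]

end Contraction

end PolyForm

end

/-! ### Assembly of the simplicial contraction. -/

theorem theorem3p2 (K : Type*) [Field K] [CharZero K] :
    (∀ m : ℕ, LinearMap.IsProj (PolyForm.whitneySpace K m) (PolyForm.whitneyProj K m)) ∧
    (∀ m : ℕ, PolyForm.manetti K m ∘ₗ PolyForm.d K m + PolyForm.d K m ∘ₗ PolyForm.manetti K m =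
      PolyForm.whitneyProj K m - LinearMap.id) ∧
    (∀ (p m : ℕ) (g : Fin (p + 1) →o Fin (m + 1)),
      PolyForm.manetti K p ∘ₗ (PolyForm.pullback (K := K) g).toLinearMap =
        (PolyForm.pullback (K := K) g).toLinearMap ∘ₗ PolyForm.manetti K m) ∧
    ∃ (hd : ∀ m : ℕ, ∀ η ∈ PolyForm.whitneySpace K m, PolyForm.d K m η ∈ PolyForm.whitneySpace K m)
      (hg : ∀ {p m : ℕ} (g : Fin (p + 1) →o Fin (m + 1)), ∀ η ∈ PolyForm.whitneySpace K m,
        (PolyForm.pullback (K := K) g).toLinearMap η ∈ PolyForm.whitneySpace K p)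
      (hπ : ∀ m : ℕ, ∀ η : PolyForm.Omega K m, PolyForm.whitneyProj K m η ∈ PolyForm.whitneySpace K m),
      PolyForm.IsSimplicialContraction
        (M := fun m => PolyForm.whitneySpace K m) (N := fun m => PolyForm.Omega K m)
        (fun m p => (PolyForm.grade K m p).comap (PolyForm.whitneySpace K m).subtype)
        (fun m => (PolyForm.d K m).restrict (hd m))
        (fun g => (PolyForm.pullback (K := K) g).toLinearMap.restrict (hg g))
        (fun m => PolyForm.grade K m)
        (fun m => PolyForm.d K m)
        (fun g => (PolyForm.pullback (K := K) g).toLinearMap)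
        (fun m => (PolyForm.whitneySpace K m).subtype)
        (fun m => PolyForm.manetti K m)
        (fun m => (PolyForm.whitneyProj K m).codRestrict (PolyForm.whitneySpace K m) (hπ m)) := by
  refine ⟨PolyForm.isProj_whitneyProj, PolyForm.manetti_d_add_d_manetti,
    fun p m g => PolyForm.manetti_pullback g, fun m η => PolyForm.d_mem_whitneySpace,
    fun g η => PolyForm.pullback_mem_whitneySpace g, fun m => PolyForm.whitneyProj_mem, ?_⟩
  refine
    { isContraction := fun m =>
        { isDG_left := ⟨PolyForm.isInternal_whitneySpace m,
            fun p v hv => PolyForm.d_mem_grade hv, ?_⟩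
          isDG_right := ⟨PolyForm.isInternal_grade m, fun p v => PolyForm.d_mem_grade,
            PolyForm.d_comp_d m⟩
          isDGHom_i := ⟨fun p v hv => hv, rfl⟩
          isDGHom_π := ⟨fun p v hv => PolyForm.whitneyProj_mem_grade hv, ?_⟩
          h_mem := fun p v => PolyForm.manetti_mem_grade
          h_zero := fun v => PolyForm.manetti_eq_zero
          π_comp_i := ?_
          homotopy := ?_ }
      map_id := fun m => ?_
      map_comp := fun g f => ?_
      isDGHom_map := fun g => ⟨fun p v => PolyForm.pullback_mem_grade g, PolyForm.pullback_d g⟩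
      map_h := fun g => (PolyForm.manetti_pullback g).symm
      map_hat := fun g => ?_ }
  · exact LinearMap.ext fun a =>
      Subtype.ext (LinearMap.congr_fun (PolyForm.d_comp_d (K := K) m) (a : PolyForm.Omega K m))
  · exact LinearMap.ext fun a =>
      Subtype.ext (LinearMap.congr_fun (PolyForm.whitneyProj_comp_d (K := K) m) a)
  · exact LinearMap.ext fun a => Subtype.ext (PolyForm.whitneyProj_of_mem a.2)
  · rw [add_comm, PolyForm.manetti_d_add_d_manetti, LinearMap.subtype_comp_codRestrict]
  · exact congrArg AlgHom.toLinearMap PolyForm.pullback_id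
  · exact congrArg AlgHom.toLinearMap (PolyForm.pullback_comp g f)
  -- The induced map π g^* i is the restriction of g^*, because g^* already lands in the Whitney
  -- space, which π fixes.
  · exact LinearMap.ext fun a => Subtype.ext
      (PolyForm.whitneyProj_of_mem (PolyForm.pullback_mem_whitneySpace g a.2)).symm
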